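/- Let $(\overline M^{m+n},\bar g)$ be a smooth Riemannian manifold with $m\ge 2$, let $x:\Sigma^m\to\overline M$ be an isometrically immersed submanifold, with second fundamental form $\mathrm{II}_\Sigma(u,v)=(\overline\nabla_u V)^{\perp}$ ($\overline\nabla$ the Levi-Civita connection of $\bar g$, $V$ any tangent extension of $v$) and mean curvature vector $\mathrm H_\Sigma=\frac1m\,\mathrm{trace}\,\mathrm{II}_\Sigma$. Let $q\in\Sigma$ be an umbilic point, i.e. $\mathrm{II}_\Sigma(u,v)=\bar g(u,v)\,\mathrm H_\Sigma(q)$ for all $u,v\in T_q\Sigma$. Fix an integer $0<s\le m-1$. Let $M$ be an (immersed) $(s+n)$-dimensional submanifold of $\overline M$ through $q$ which is totally geodesic at $q$ (each geodesic of $M$ starting at $q$ is, for times near $0$, a geodesic of $\overline M$) and satisfies $T_q^{\perp}\Sigma\subset T_qM$. Then near $q$ the intersection $\Sigma\cap M$ is an $s$-dimensional submanifold, and its mean curvature vector at $q$, as a submanifold of $\overline M$, coincides with the mean curvature vector of $\Sigma$ at $q$: $$\mathrm H_{\Sigma\cap M}(q)=\mathrm H_\Sigma(q).$$ Here, if $\Sigma$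 and $M$ are given by immersions $x$ and $y$ with $x(q)=y(p)$, the intersection near $q$ means the set $\{(a,b)\in\Sigma\times M: x(a)=y(b)\}$ near $(q,p)$, mapped to $\overline M$ by $x(a)=y(b)$. -/

import Mathlib

open scoped Manifold ContDiff Topology Matrix
open Bundle

noncomputable section

/-- A field of bilinear forms on the tangent spaces of a `d`-dimensional manifold. -/
abbrev MetricField (d : ℕ) (N : Type*) [TopologicalSpace N]
    [ChartedSpace (EuclideanSpace ℝ (Fin d)) N] : Type _ :=
  ∀ p : N, TangentSpace (𝓡 d) p →L[ℝ] TangentSpace (𝓡 d) p →L[ℝ] ℝ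

/-- A smooth Riemannian metric on a `d`-dimensional manifold. -/
abbrev SmoothMetric (d : ℕ) (N : Type*) [TopologicalSpace N]
    [ChartedSpace (EuclideanSpace ℝ (Fin d)) N] [IsManifold (𝓡 d) ∞ N] : Type _ :=
  ContMDiffRiemannianMetric (𝓡 d) ∞ (EuclideanSpace ℝ (Fin d))
    (fun p : N => TangentSpace (𝓡 d) p)

section LeviCivita

variable {d : ℕ} {N : Type*} [TopologicalSpace N] [ChartedSpace (EuclideanSpace ℝ (Fin d)) N]

/-- The metric coefficients in the preferred chart `φ` at `p`: the bilinear form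
`(u, v) ↦ G (dφ⁻¹ u) (dφ⁻¹ v)` at the coordinate point `z`. -/
def metricInChart (G : MetricField d N) (p : N) (z : EuclideanSpace ℝ (Fin d)) :
    EuclideanSpace ℝ (Fin d) →L[ℝ] EuclideanSpace ℝ (Fin d) →L[ℝ] ℝ :=
  let A : EuclideanSpace ℝ (Fin d) →L[ℝ] TangentSpace (𝓡 d) ((extChartAt (𝓡 d) p).symm z) :=
    mfderiv 𝓘(ℝ, EuclideanSpace ℝ (Fin d)) (𝓡 d) (extChartAt (𝓡 d) p).symm z
  (ContinuousLinearMap.precomp ℝ A) ∘L (G ((extChartAt (𝓡 d) p).symm z)) ∘L A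

/-- The Christoffel symbols `Γ_z(u, v)` of the Levi-Civita connection of `G` in the preferred chart
at `p`: the vector `w` such that, for all `h`,
`G_z(w, h) = (D_u G_z(v, h) + D_v G_z(u, h) - D_h G_z(u, v)) / 2`. -/
def christoffel (G : MetricField d N) (p : N) (z u v : EuclideanSpace ℝ (Fin d)) :
    EuclideanSpace ℝ (Fin d) :=
  let DG := fderiv ℝ (metricInChart G p) z
  (metricInChart G p z).inverse ((2⁻¹ : ℝ) • (DG u v + DG v u - (DG.flip u).flip v))

/-- The curve `γ` is a geodesic of `G` for times near `t₀`: it is `C²` at `t₀`, and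
`c'' + Γ(c', c') = 0` near `t₀` for its expression `c` in the preferred chart at `γ t₀`. -/
def IsGeodesicAt (G : MetricField d N) (γ : ℝ → N) (t₀ : ℝ) : Prop :=
  ContMDiffAt 𝓘(ℝ, ℝ) (𝓡 d) 2 γ t₀ ∧
    let c : ℝ → EuclideanSpace ℝ (Fin d) := fun t => extChartAt (𝓡 d) (γ t₀) (γ t)
    ∀ᶠ t in 𝓝 t₀, deriv (deriv c) t + christoffel G (γ t₀) (c t) (deriv c t) (deriv c t) = 0

variable (k : ℕ) {B : Type*} [TopologicalSpace B] [ChartedSpace (EuclideanSpace ℝ (Fin k)) B]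

/-- The covariant derivative `∇_u V` at `b`, for the Levi-Civita connection of `G`, of a vector
field `V` along a map `f : B → N`, in the direction of a tangent vector `u` of `B`. In the
preferred chart `φ` at `f b` it is `d(dφ V)(u) + Γ(dφ (df u), dφ V)`; the coordinate vector is
carried back to the tangent space at `f b` by the inverse of `dφ`. -/
def covDerivAlong (G : MetricField d N) (f : B → N) (V : ∀ b, TangentSpace (𝓡 d) (f b)) (b : B)
    (u : TangentSpace (𝓡 k) b) : TangentSpace (𝓡 d) (f b) :=
  let dφ : ∀ p : N, TangentSpace (𝓡 d) p →L[ℝ] EuclideanSpace ℝ (Fin d) :=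
    mvfderiv (𝓡 d) (extChartAt (𝓡 d) (f b))
  (dφ (f b)).inverse
    (mvfderiv (𝓡 k) (fun b' => dφ (f b') (V b')) b u +
      christoffel G (f b) (extChartAt (𝓡 d) (f b) (f b))
        (dφ (f b) (mfderiv (𝓡 k) (𝓡 d) f b u)) (dφ (f b) (V b)))

end LeviCivita

section Immersions

variable (d k : ℕ) {N : Type*} [TopologicalSpace N] [ChartedSpace (EuclideanSpace ℝ (Fin d)) N]
  {B : Type*} [TopologicalSpace B] [ChartedSpace (EuclideanSpace ℝ (Fin k)) B]

/-- An immersion: a smooth map with injective differentials. -/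
def IsSmoothImmersion (x : B → N) : Prop :=
  ContMDiff (𝓡 k) (𝓡 d) ∞ x ∧ ∀ b, Function.Injective (mfderiv (𝓡 k) (𝓡 d) x b)

variable {d}

/-- The metric induced by `x` on `B`, i.e. the only one for which an immersion `x` is isometric. -/
def inducedMetric (G : MetricField d N) (x : B → N) : MetricField k B := fun b =>
  (ContinuousLinearMap.precomp ℝ (mfderiv (𝓡 k) (𝓡 d) x b)) ∘L (G (x b)) ∘L
    (mfderiv (𝓡 k) (𝓡 d) x b)

/-- The normal space `T_b^⊥ B`, inside the tangent space of the ambient manifold. -/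
def normalSpace (G : MetricField d N) (x : B → N) (b : B) :
    Submodule ℝ (TangentSpace (𝓡 d) (x b)) where
  carrier := {w | ∀ u : TangentSpace (𝓡 k) b, G (x b) (mfderiv (𝓡 k) (𝓡 d) x b u) w = 0}
  add_mem' := by
    intro v w hv hw u
    simp [hv u, hw u]
  zero_mem' := by
    intro u
    simp
  smul_mem' := by
    intro c w hw u
    simp [hw u]

/-- The `i`-th vector of the coordinate basis of the tangent space at `b`. -/
def coordVec (b : B) (i : Fin k) : TangentSpace (𝓡 k) b :=
  (mvfderiv (𝓡 k) (extChartAt (𝓡 k) b) b).inverse (EuclideanSpace.single i (1 : ℝ))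

/-- The coefficients `g^{ij}`: the inverse of the matrix `g_{ij}` of the induced metric at `b`. -/
def inverseGram (G : MetricField d N) (x : B → N) (b : B) : Matrix (Fin k) (Fin k) ℝ :=
  (Matrix.of fun i j => inducedMetric k G x b (coordVec k b i) (coordVec k b j))⁻¹

/-- The component of `w` normal to the immersion `x` at `b`:
`w - ∑ g^{ij} G(dx e_j, w) dx e_i`. -/
def normalPart (G : MetricField d N) (x : B → N) (b : B) (w : TangentSpace (𝓡 d) (x b)) :
    TangentSpace (𝓡 d) (x b) :=
  w - ∑ i, ∑ j, (inverseGram k G x b i j * G (x b) (mfderiv (𝓡 k) (𝓡 d) x b (coordVec k b j)) w) •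
    mfderiv (𝓡 k) (𝓡 d) x b (coordVec k b i)

variable [IsManifold (𝓡 k) ∞ B]

/-- The second fundamental form of the immersion `x` at `b`: the normal component of `∇_u (dx Y)`,
where `∇` is the Levi-Civita connection of the ambient metric and `Y` is a vector field which
extends `v` near `b`. -/
def secondFundamentalForm (G : MetricField d N) (x : B → N) (b : B)
    (u v : TangentSpace (𝓡 k) b) : TangentSpace (𝓡 d) (x b) :=
  let Y : ∀ b' : B, TangentSpace (𝓡 k) b' :=
    FiberBundle.extend (EuclideanSpace ℝ (Fin k)) v
  normalPart k G x b
    (covDerivAlong k G x (fun b' => mfderiv (𝓡 k) (𝓡 d) x b' (Y b')) b u)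

/-- The mean curvature vector at `b`: the trace `∑ g^{ij} II(e_i, e_j)` of the second fundamental
form for the induced metric, divided by the dimension `k`. -/
def meanCurvatureVector (G : MetricField d N) (x : B → N) (b : B) : TangentSpace (𝓡 d) (x b) :=
  (k : ℝ)⁻¹ • ∑ i, ∑ j,
    inverseGram k G x b i j • secondFundamentalForm k G x b (coordVec k b i) (coordVec k b j)

/-- The point `b` is umbilic: the second fundamental form there is the induced metric times the
mean curvature vector. -/
def IsUmbilicAt (G : MetricField d N) (x : B → N) (b : B) : Prop :=
  ∀ u v : TangentSpace (𝓡 k) b,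
    secondFundamentalForm k G x b u v = inducedMetric k G x b u v • meanCurvatureVector k G x b

/-- The immersion `x` is totally geodesic at `b`: it carries each geodesic of `B` (for the induced
metric) that starts at `b` to a geodesic of the ambient manifold, for times near `0`. -/
def IsTotallyGeodesicAt (G : MetricField d N) (x : B → N) (b : B) : Prop :=
  ∀ γ : ℝ → B, γ 0 = b → IsGeodesicAt (inducedMetric k G x) γ 0 → IsGeodesicAt G (x ∘ γ) 0

end Immersions

section Intersection

variable (d m l s : ℕ) {N : Type*} [TopologicalSpace N]
  [ChartedSpace (EuclideanSpace ℝ (Fin d)) N]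
  {Sig : Type*} [TopologicalSpace Sig] [ChartedSpace (EuclideanSpace ℝ (Fin m)) Sig]
  {M : Type*} [TopologicalSpace M] [ChartedSpace (EuclideanSpace ℝ (Fin l)) M]
  {S : Type*} [TopologicalSpace S] [ChartedSpace (EuclideanSpace ℝ (Fin s)) S]

/-- The manifold `S`, with the maps `α : S → Sig` and `β : S → M`, is the intersection of the
immersed submanifolds `x : Sig → N` and `y : M → N` near the point given by `q` and `p`: it is
immersed in `N` by `x ∘ α = y ∘ β`, and `(α, β)` identifies it, as a topological space, with a
neighbourhood of `(q, p)` in `{(a, b) | x a = y b}`; the point `o` of `S` is the one over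
`(q, p)`. (If `x` and `y` are inclusions of subsets with the subspace topology, then
`{(a, b) | x a = y b}` is the intersection of these subsets.) -/
structure IsIntersectionNear (x : Sig → N) (y : M → N) (q : Sig) (p : M)
    (α : S → Sig) (β : S → M) (o : S) : Prop where
  left_base : α o = q
  right_base : β o = p
  smooth_left : ContMDiff (𝓡 s) (𝓡 m) ∞ α
  smooth_right : ContMDiff (𝓡 s) (𝓡 l) ∞ β
  comm : ∀ z, x (α z) = y (β z)
  immersion : IsSmoothImmersion d s (x ∘ α)
  embedding : Topology.IsEmbedding fun z => (α z, β z)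
  covers : ∀ᶠ w : Sig × M in 𝓝 (q, p), x w.1 = y w.2 → ∃ z, (α z, β z) = w

end Intersection

end

open scoped Manifold ContDiff Topology Matrix
open Bundle

noncomputable section

set_option maxSynthPendingDepth 3
set_option linter.unusedSectionVars false

/-! For an immersion f, let Hess f(u, v) = D²F(u, v) + Γ(DF u, DF v) be its covariant Hessian in
charts (`coordHessian`). The second fundamental form is its normal part
(`secondFundamentalForm_eq`), and `coordHessian_comp` gives Hess(x ∘ α)(u, v) = Hess x(dα u, dα v) +
dx(D²α(u, v)), so composition changes the Hessian only by vectors tangent to x.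

Put f = x ∘ α = y ∘ β for the immersion of the intersection and H for the mean curvature vector of x
at q. Umbilicity says that Hess f(u, v) - ⟨u, v⟩H lies in the range of dx. Total geodesy at p puts
Hess y, hence Hess f, in the range of dy (`coordHessian_mem_range`: follow a geodesic in each
direction, then polarize). H is normal to x, so by hypothesis it also lies in the range of dy. The
difference is therefore in range dx ∩ range dy, which is range df by a dimension count, since the
two ranges span (`range_inf_range_le`, `range_sup_range_eq_top`). As H is normal to f too, the
second fundamental form of f is ⟨u, v⟩H: the intersection is itself umbilic, and its trace gives H
(`meanCurvatureVector_comp_eq`).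

The intersection exists by transversality: in charts it is the zero set of X(a) - Y(b), a submersion
at the base point, which the inverse function theorem straightens (`exists_isIntersectionNear`). -/

theorem mvfderiv_extChartAt_self {k : ℕ} {B : Type*} [TopologicalSpace B]
    [ChartedSpace (EuclideanSpace ℝ (Fin k)) B] [IsManifold (𝓡 k) ∞ B] (b : B) :
    mvfderiv (𝓡 k) (extChartAt (𝓡 k) b) b =
      ContinuousLinearMap.id ℝ (EuclideanSpace ℝ (Fin k)) := by
  have := mfderiv_extChartAt_self (I := 𝓡 k) (x := b)
  unfold mvfderiv
  rw [this]
  rfl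

/-! ### Coordinate vectors and the Gram matrix -/

section Gram

variable {d k : ℕ} {N : Type*} [TopologicalSpace N] [ChartedSpace (EuclideanSpace ℝ (Fin d)) N]
  {B : Type*} [TopologicalSpace B] [ChartedSpace (EuclideanSpace ℝ (Fin k)) B]

theorem inducedMetric_apply (G : MetricField d N) (x : B → N) (b : B) (u v : TangentSpace (𝓡 k) b) :
    inducedMetric k G x b u v =
      G (x b) (mfderiv (𝓡 k) (𝓡 d) x b u) (mfderiv (𝓡 k) (𝓡 d) x b v) := rfl

/-- The matrix of the induced metric in the coordinate basis. -/
def gramMatrix (G : MetricField d N) (x : B → N) (b : B) : Matrix (Fin k) (Fin k) ℝ :=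
  Matrix.of fun i j => inducedMetric k G x b (coordVec k b i) (coordVec k b j)

theorem gramMatrix_mulVec (G : MetricField d N) (x : B → N) (b : B) (c : Fin k → ℝ) (i : Fin k) :
    (gramMatrix G x b *ᵥ c) i =
      inducedMetric k G x b (coordVec k b i) (∑ j, c j • coordVec k b j) := by
  simp [gramMatrix, Matrix.mulVec, dotProduct, mul_comm]

variable [IsManifold (𝓡 k) ∞ B]

theorem inverse_mvfderiv_extChartAt_self_apply (b : B) (v : EuclideanSpace ℝ (Fin k)) :
    (mvfderiv (𝓡 k) (extChartAt (𝓡 k) b) b).inverse v = v := by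
  rw [mvfderiv_extChartAt_self]
  exact congrArg (· v) (ContinuousLinearMap.inverse_id (R := ℝ) (M := EuclideanSpace ℝ (Fin k)))

theorem coordVec_eq (b : B) (i : Fin k) : coordVec k b i = EuclideanSpace.single i (1 : ℝ) :=
  inverse_mvfderiv_extChartAt_self_apply b _

theorem sum_smul_coordVec (b : B) (c : Fin k → ℝ) :
    ∑ i, c i • coordVec k b i = WithLp.toLp 2 c := by
  simp_rw [coordVec_eq]
  have h := (EuclideanSpace.basisFun (Fin k) ℝ).sum_repr (WithLp.toLp 2 c)
  simp only [EuclideanSpace.basisFun_apply, EuclideanSpace.basisFun_repr] at h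
  exact h

theorem exists_sum_smul_coordVec (b : B) (u : TangentSpace (𝓡 k) b) :
    ∃ c : Fin k → ℝ, ∑ i, c i • coordVec k b i = u :=
  ⟨WithLp.ofLp (show EuclideanSpace ℝ (Fin k) from u), sum_smul_coordVec b _⟩

end Gram

/-! ### Tangential and normal components -/

section NormalPart

variable {d k : ℕ} {N : Type*} [TopologicalSpace N] [ChartedSpace (EuclideanSpace ℝ (Fin d)) N]
  [IsManifold (𝓡 d) ∞ N]
  {B : Type*} [TopologicalSpace B] [ChartedSpace (EuclideanSpace ℝ (Fin k)) B]
  (g : SmoothMetric d N) {x : B → N} {b : B}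

theorem inducedMetric_symm (u v : TangentSpace (𝓡 k) b) :
    inducedMetric k g.inner x b u v = inducedMetric k g.inner x b v u :=
  g.symm _ _ _

theorem eq_zero_of_inducedMetric_self (hx : Function.Injective (mfderiv (𝓡 k) (𝓡 d) x b))
    {u : TangentSpace (𝓡 k) b} (hu : inducedMetric k g.inner x b u u = 0) : u = 0 := by
  by_contra h
  exact (g.pos (x b) _ fun h0 => h (hx (h0.trans (map_zero _).symm))).ne' hu

variable [IsManifold (𝓡 k) ∞ B]

/-- A kernel vector gives a tangent vector orthogonal to every coordinate vector, hence to itself,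
so it vanishes by positivity. This makes `inverseGram` a true inverse rather than the default value.
-/
theorem isUnit_gramMatrix (hx : Function.Injective (mfderiv (𝓡 k) (𝓡 d) x b)) :
    IsUnit (gramMatrix (k := k) g.inner x b) := by
  rw [← Matrix.mulVec_injective_iff_isUnit]
  refine (injective_iff_map_eq_zero (gramMatrix g.inner x b).mulVecLin).2 fun c hc => ?_
  have hi (i : Fin k) : inducedMetric k g.inner x b (coordVec k b i)
      (∑ j, c j • coordVec k b j) = 0 := by
    rw [← gramMatrix_mulVec]
    exact congrFun hc i
  have key (w : TangentSpace (𝓡 k) b) (hw : ∀ i, inducedMetric k g.inner x b (coordVec k b i) w = 0) :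
      inducedMetric k g.inner x b (∑ i, c i • coordVec k b i) w = 0 := by
    rw [map_sum, sum_apply]
    exact Finset.sum_eq_zero fun i _ => by rw [map_smul, smul_apply, hw, smul_zero]
  have h0 := eq_zero_of_inducedMetric_self g hx (key _ hi)
  rw [sum_smul_coordVec] at h0
  exact (WithLp.toLp_injective 2) h0

theorem inverseGram_mul_gramMatrix (hx : Function.Injective (mfderiv (𝓡 k) (𝓡 d) x b)) :
    inverseGram k g.inner x b * gramMatrix g.inner x b = 1 :=
  Matrix.nonsing_inv_mul _ ((Matrix.isUnit_iff_isUnit_det _).1 (isUnit_gramMatrix g hx))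

theorem gramMatrix_mul_inverseGram (hx : Function.Injective (mfderiv (𝓡 k) (𝓡 d) x b)) :
    gramMatrix g.inner x b * inverseGram k g.inner x b = 1 :=
  Matrix.mul_nonsing_inv _ ((Matrix.isUnit_iff_isUnit_det _).1 (isUnit_gramMatrix g hx))

/-- The tangential component of a vector, in terms of the coordinate basis. -/
theorem normalPart_eq (G : MetricField d N) (w : TangentSpace (𝓡 d) (x b)) :
    normalPart k G x b w = w - mfderiv (𝓡 k) (𝓡 d) x b
      (∑ i, (inverseGram k G x b *ᵥ
        fun j => G (x b) (mfderiv (𝓡 k) (𝓡 d) x b (coordVec k b j)) w) i • coordVec k b i) := by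
  simp [normalPart, Matrix.mulVec, dotProduct, Finset.sum_smul]

theorem exists_mfderiv_add_normalPart (G : MetricField d N) (x : B → N) (b : B)
    (w : TangentSpace (𝓡 d) (x b)) :
    ∃ u, mfderiv (𝓡 k) (𝓡 d) x b u + normalPart k G x b w = w :=
  ⟨_, by rw [normalPart_eq, add_sub_cancel]⟩

theorem normalPart_mem (hx : Function.Injective (mfderiv (𝓡 k) (𝓡 d) x b))
    (w : TangentSpace (𝓡 d) (x b)) :
    normalPart k g.inner x b w ∈ normalSpace k g.inner x b := by
  intro u
  obtain ⟨c, rfl⟩ := exists_sum_smul_coordVec b u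
  rw [map_sum, map_sum, sum_apply]
  refine Finset.sum_eq_zero fun i _ => ?_
  rw [map_smul, map_smul, smul_apply, normalPart_eq, map_sub,
    ← inducedMetric_apply, ← gramMatrix_mulVec, Matrix.mulVec_mulVec,
    gramMatrix_mul_inverseGram g hx]
  simp

/-- The inverse Gram matrix recovers the coefficients of the tangential summand. Together with
`normalPart_mem` this identifies `normalPart` as the orthogonal projection. -/
theorem normalPart_add (hx : Function.Injective (mfderiv (𝓡 k) (𝓡 d) x b))
    (u : TangentSpace (𝓡 k) b) {w : TangentSpace (𝓡 d) (x b)}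
    (hw : w ∈ normalSpace k g.inner x b) :
    normalPart k g.inner x b (mfderiv (𝓡 k) (𝓡 d) x b u + w) = w := by
  obtain ⟨c, rfl⟩ := exists_sum_smul_coordVec b u
  have h : (fun j => g.inner (x b) (mfderiv (𝓡 k) (𝓡 d) x b (coordVec k b j))
      (mfderiv (𝓡 k) (𝓡 d) x b (∑ i, c i • coordVec k b i) + w)) =
      gramMatrix g.inner x b *ᵥ c := by
    funext j
    rw [map_add, hw, add_zero, gramMatrix_mulVec, inducedMetric_apply]
  rw [normalPart_eq, h, Matrix.mulVec_mulVec, inverseGram_mul_gramMatrix g hx, Matrix.one_mulVec,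
    add_sub_cancel_left]

/-- If the second fundamental form is the induced metric times `H`, then `H` is the mean
curvature vector. -/
theorem meanCurvatureVector_eq_of_secondFundamentalForm_eq (hk : 0 < k)
    (hx : Function.Injective (mfderiv (𝓡 k) (𝓡 d) x b)) {H : TangentSpace (𝓡 d) (x b)}
    (h : ∀ u v, secondFundamentalForm k g.inner x b u v = inducedMetric k g.inner x b u v • H) :
    meanCurvatureVector k g.inner x b = H := by
  -- These are the diagonal entries of g⁻¹g; each index contributes 1, so the trace of the metric is
  -- `k`.
  have h1 (i : Fin k) : ∑ j, inverseGram k g.inner x b i j *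
      inducedMetric k g.inner x b (coordVec k b i) (coordVec k b j) = 1 := by
    have := congrFun (congrFun (inverseGram_mul_gramMatrix g hx) i) i
    rw [Matrix.mul_apply, Matrix.one_apply_eq] at this
    rw [← this]
    refine Finset.sum_congr rfl fun j _ => ?_
    rw [inducedMetric_symm]
    rfl
  have hk' : (k : ℝ) ≠ 0 := by exact_mod_cast hk.ne'
  simp only [meanCurvatureVector, h, smul_smul, ← Finset.sum_smul, h1]
  simp [hk']

theorem meanCurvatureVector_mem (hx : Function.Injective (mfderiv (𝓡 k) (𝓡 d) x b)) :
    meanCurvatureVector k g.inner x b ∈ normalSpace k g.inner x b :=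
  Submodule.smul_mem _ _ <| Submodule.sum_mem _ fun _ _ => Submodule.sum_mem _ fun _ _ =>
    Submodule.smul_mem _ _ (normalPart_mem g hx _)

end NormalPart

/-! ### Christoffel symbols in a normed space: symmetry and smoothness -/

section FirstKind

variable {V : Type*} [NormedAddCommGroup V] [NormedSpace ℝ V]

/-- The Christoffel symbols of the first kind, as a linear form, in terms of the derivative `D` of
the metric coefficients. -/
def christoffelForm (D : V →L[ℝ] V →L[ℝ] V →L[ℝ] ℝ) (u v : V) : V →L[ℝ] ℝ :=
  (2⁻¹ : ℝ) • (D u v + D v u - (D.flip u).flip v)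

theorem christoffelForm_apply (D : V →L[ℝ] V →L[ℝ] V →L[ℝ] ℝ) (u v h : V) :
    christoffelForm D u v h = 2⁻¹ * (D u v h + D v u h - D h u v) := rfl

theorem christoffelForm_add (D : V →L[ℝ] V →L[ℝ] V →L[ℝ] ℝ) (u u' v : V) :
    christoffelForm D (u + u') v = christoffelForm D u v + christoffelForm D u' v := by
  ext h
  simp only [christoffelForm_apply, map_add, add_apply]
  ring

theorem christoffelForm_symm {D : V →L[ℝ] V →L[ℝ] V →L[ℝ] ℝ}
    (hD : ∀ u v w, D u v w = D u w v) (u v : V) :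
    christoffelForm D u v = christoffelForm D v u := by
  ext h
  simp only [christoffelForm_apply, hD h u v]
  ring

theorem contDiffAt_clm_apply_iff {U W : Type*} [NormedAddCommGroup U] [NormedSpace ℝ U]
    [NormedAddCommGroup W] [NormedSpace ℝ W] [FiniteDimensional ℝ V] {n : WithTop ℕ∞}
    {f : U → V →L[ℝ] W} {z : U} :
    ContDiffAt ℝ n f z ↔ ∀ v, ContDiffAt ℝ n (fun z => f z v) z := by
  refine ⟨fun h v => h.clm_apply contDiffAt_const, fun h => ?_⟩
  let d := Module.finrank ℝ V
  have hd : d = Module.finrank ℝ (Fin d → ℝ) := (Module.finrank_fin_fun ℝ).symm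
  let e₁ := ContinuousLinearEquiv.ofFinrankEq hd
  let e₂ := (e₁.arrowCongr (1 : W ≃L[ℝ] W)).trans (ContinuousLinearEquiv.piRing (Fin d))
  rw [← Function.id_comp f, ← e₂.symm_comp_self]
  exact e₂.symm.contDiff.contDiffAt.comp z (contDiffAt_pi.mpr fun i => h _)

/-- Swapping the two arguments is a linear isometric equivalence, which commutes with `fderiv`
unconditionally; hence no differentiability is needed. -/
theorem fderiv_apply_symm {U : Type*} [NormedAddCommGroup U] [NormedSpace ℝ U]
    {G : U → V →L[ℝ] V →L[ℝ] ℝ} (hG : ∀ z v w, G z v w = G z w v) (z u : U) (v w : V) :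
    fderiv ℝ G z u v w = fderiv ℝ G z u w v := by
  have h : (ContinuousLinearMap.flipₗᵢ ℝ V V ℝ) ∘ G = G := by
    funext z
    ext v w
    exact hG z w v
  have h1 := (ContinuousLinearMap.flipₗᵢ ℝ V V ℝ).comp_fderiv (f := G) (x := z)
  rw [h] at h1
  nth_rw 1 [h1]
  rfl

/-- A finite-dimensional space and its dual have equal dimension. Nondegeneracy thus makes
`ContinuousLinearMap.inverse` genuine, and smooth, at this point. -/
theorem isInvertible_of_injective_dual [FiniteDimensional ℝ V] {L : V →L[ℝ] V →L[ℝ] ℝ}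
    (hL : Function.Injective L) : L.IsInvertible := by
  have hr : Module.finrank ℝ V = Module.finrank ℝ (V →L[ℝ] ℝ) := by
    rw [← (LinearMap.toContinuousLinearMap (𝕜 := ℝ) (E := V) (F' := ℝ)).finrank_eq]
    exact Subspace.dual_finrank_eq.symm
  exact ⟨(LinearEquiv.ofInjectiveOfFinrankEq (L : V →ₗ[ℝ] V →L[ℝ] ℝ) hL hr).toContinuousLinearEquiv,
    by ext; rfl⟩

theorem contDiffAt_inverse_christoffelForm [FiniteDimensional ℝ V] {G : V → V →L[ℝ] V →L[ℝ] ℝ}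
    {z : V} (hG : ContDiffAt ℝ ∞ G z) (hi : Function.Injective (G z)) (v : V) :
    ContDiffAt ℝ ∞ (fun w : V × V => (G w.1).inverse (christoffelForm (fderiv ℝ G w.1) w.2 w.2))
      (z, v) := by
  have hG' : ContDiffAt ℝ ∞ (fun w : V × V => G w.1) (z, v) :=
    ContDiffAt.comp (z, v) hG contDiffAt_fst
  have hD : ContDiffAt ℝ ∞ (fun w : V × V => fderiv ℝ G w.1) (z, v) :=
    ContDiffAt.comp (z, v) (hG.fderiv_right (m := ∞) (by simp)) contDiffAt_fst
  have hs : ContDiffAt ℝ ∞ (fun w : V × V => w.2) (z, v) := contDiffAt_snd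
  have hI : ContDiffAt ℝ ∞ (fun w : V × V => (G w.1).inverse) (z, v) :=
    ContDiffAt.comp (g := ContinuousLinearMap.inverse) (z, v)
      (isInvertible_of_injective_dual hi).contDiffAt_map_inverse hG'
  refine hI.clm_apply ?_
  refine contDiffAt_clm_apply_iff.2 fun h => ?_
  simp only [christoffelForm_apply]
  have h1 := ((hD.clm_apply hs).clm_apply hs).clm_apply (contDiffAt_const (c := h))
  have h2 := ((hD.clm_apply (contDiffAt_const (c := h))).clm_apply hs).clm_apply hs
  exact contDiffAt_const.mul ((h1.add h1).sub h2)

end FirstKind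

/-! ### Christoffel symbols of a metric in a chart -/

section Christoffel

variable {d : ℕ} {N : Type*} [TopologicalSpace N] [ChartedSpace (EuclideanSpace ℝ (Fin d)) N]

theorem christoffel_eq (G : MetricField d N) (p : N) (z u v : EuclideanSpace ℝ (Fin d)) :
    christoffel G p z u v = (metricInChart G p z).inverse
      (christoffelForm (fderiv ℝ (metricInChart G p) z) u v) := rfl

/-- The Christoffel symbols, evaluated on `(v, v)`, depend smoothly on the coordinate point
and on `v`, where the metric is smooth and nondegenerate. -/
theorem contDiffAt_christoffel {G : MetricField d N} {p : N} {z : EuclideanSpace ℝ (Fin d)}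
    (hG : ContDiffAt ℝ ∞ (metricInChart G p) z)
    (hi : Function.Injective (metricInChart G p z)) (v : EuclideanSpace ℝ (Fin d)) :
    ContDiffAt ℝ ∞ (fun w : EuclideanSpace ℝ (Fin d) × EuclideanSpace ℝ (Fin d) =>
      christoffel G p w.1 w.2 w.2) (z, v) :=
  contDiffAt_inverse_christoffelForm hG hi v

theorem christoffel_add (G : MetricField d N) (p : N) (z u u' v : EuclideanSpace ℝ (Fin d)) :
    christoffel G p z (u + u') v = christoffel G p z u v + christoffel G p z u' v := by
  rw [christoffel_eq, christoffelForm_add, map_add]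
  rfl

theorem metricInChart_apply (G : MetricField d N) (p : N) (z u v : EuclideanSpace ℝ (Fin d)) :
    metricInChart G p z u v = G ((extChartAt (𝓡 d) p).symm z)
      (mfderiv 𝓘(ℝ, EuclideanSpace ℝ (Fin d)) (𝓡 d) (extChartAt (𝓡 d) p).symm z u)
      (mfderiv 𝓘(ℝ, EuclideanSpace ℝ (Fin d)) (𝓡 d) (extChartAt (𝓡 d) p).symm z v) := rfl

variable [IsManifold (𝓡 d) ∞ N]

theorem christoffel_symm (g : SmoothMetric d N) (p : N) (z u v : EuclideanSpace ℝ (Fin d)) :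
    christoffel g.inner p z u v = christoffel g.inner p z v u := by
  rw [christoffel_eq, christoffel_eq, christoffelForm_symm]
  exact fun u v w => fderiv_apply_symm (fun z v w => g.symm _ _ _) z u v w

theorem christoffel_add_self (g : SmoothMetric d N) (p : N) (z u v : EuclideanSpace ℝ (Fin d)) :
    christoffel g.inner p z (u + v) (u + v) = christoffel g.inner p z u u +
      (2 : ℝ) • christoffel g.inner p z u v + christoffel g.inner p z v v := by
  rw [christoffel_add, christoffel_symm g p z u, christoffel_symm g p z v (u + v),
    christoffel_add, christoffel_add, christoffel_symm g p z v u, two_smul]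
  abel

end Christoffel

/-! ### Smoothness and nondegeneracy of metric coefficients -/

section MetricInChart

variable {d k : ℕ} {N : Type*} [TopologicalSpace N] [ChartedSpace (EuclideanSpace ℝ (Fin d)) N]
  {B : Type*} [TopologicalSpace B] [ChartedSpace (EuclideanSpace ℝ (Fin k)) B]

theorem contDiffAt_writtenInExtChartAt {f : B → N} {b : B}
    (hf : ContMDiffAt (𝓡 k) (𝓡 d) ∞ f b) :
    ContDiffAt ℝ ∞ (writtenInExtChartAt (𝓡 k) (𝓡 d) b f) (extChartAt (𝓡 k) b b) := by
  have := (contMDiffAt_iff.1 hf).2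
  simpa [contDiffWithinAt_univ] using this

theorem mfderiv_eq_fderiv_writtenInExtChartAt {f : B → N} {b : B}
    (hf : ContMDiffAt (𝓡 k) (𝓡 d) ∞ f b) :
    mfderiv (𝓡 k) (𝓡 d) f b =
      fderiv ℝ (writtenInExtChartAt (𝓡 k) (𝓡 d) b f) (extChartAt (𝓡 k) b b) := by
  have h : MDifferentiableAt (𝓡 k) (𝓡 d) f b := hf.mdifferentiableAt (by simp)
  rw [h.mfderiv]
  simp
  rfl

/-- The tangent spaces at `f z` and `f' z` are different types to the elaborator but the same
Euclidean space by definition; the congruence is carried out there. -/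
theorem apply_mfderiv_congr (G : MetricField d N) {f f' : EuclideanSpace ℝ (Fin k) → N}
    {z : EuclideanSpace ℝ (Fin k)} (h : f =ᶠ[𝓝 z] f') (u v : EuclideanSpace ℝ (Fin k)) :
    G (f z) (mfderiv 𝓘(ℝ, EuclideanSpace ℝ (Fin k)) (𝓡 d) f z u)
        (mfderiv 𝓘(ℝ, EuclideanSpace ℝ (Fin k)) (𝓡 d) f z v) =
      G (f' z) (mfderiv 𝓘(ℝ, EuclideanSpace ℝ (Fin k)) (𝓡 d) f' z u)
        (mfderiv 𝓘(ℝ, EuclideanSpace ℝ (Fin k)) (𝓡 d) f' z v) := by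
  let G' : N → EuclideanSpace ℝ (Fin d) →L[ℝ] EuclideanSpace ℝ (Fin d) →L[ℝ] ℝ := G
  have h1 : G' (f z) = G' (f' z) := congrArg G' h.eq_of_nhds
  have h2 (w : EuclideanSpace ℝ (Fin k)) :
      (mfderiv 𝓘(ℝ, EuclideanSpace ℝ (Fin k)) (𝓡 d) f z w : EuclideanSpace ℝ (Fin d)) =
        mfderiv 𝓘(ℝ, EuclideanSpace ℝ (Fin k)) (𝓡 d) f' z w :=
    congrArg (fun L : EuclideanSpace ℝ (Fin k) →L[ℝ] EuclideanSpace ℝ (Fin d) => L w) h.mfderiv_eq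
  exact congr (congrArg (fun L : EuclideanSpace ℝ (Fin d) →L[ℝ] ℝ => (L : _ → ℝ))
    (congr (congrArg (fun L : EuclideanSpace ℝ (Fin d) →L[ℝ] EuclideanSpace ℝ (Fin d) →L[ℝ] ℝ =>
      (L : _ → _)) h1) (h2 u))) (h2 v)

variable [IsManifold (𝓡 d) ∞ N]

theorem contMDiffAt_extChartAt_symm {p : N} {z : EuclideanSpace ℝ (Fin d)}
    (hz : z ∈ (extChartAt (𝓡 d) p).target) :
    ContMDiffAt 𝓘(ℝ, EuclideanSpace ℝ (Fin d)) (𝓡 d) ∞ (extChartAt (𝓡 d) p).symm z :=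
  (contMDiffOn_extChartAt_symm p).contMDiffAt ((isOpen_extChartAt_target p).mem_nhds hz)

theorem injective_mfderiv_extChartAt_symm {p : N} {z : EuclideanSpace ℝ (Fin d)}
    (hz : z ∈ (extChartAt (𝓡 d) p).target) :
    Function.Injective (mfderiv 𝓘(ℝ, EuclideanSpace ℝ (Fin d)) (𝓡 d)
      (extChartAt (𝓡 d) p).symm z) := by
  have h := isInvertible_mfderivWithin_extChartAt_symm (I := 𝓡 d) hz
  have hr : Set.range (𝓡 d) = Set.univ := by simp
  rw [hr, mfderivWithin_univ] at h
  exact h.injective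

/-- The field is the tangent map of the inverse chart applied to the constant field `u`. -/
theorem contMDiffAt_mfderiv_extChartAt_symm {p : N} {z : EuclideanSpace ℝ (Fin d)}
    (hz : z ∈ (extChartAt (𝓡 d) p).target) (u : EuclideanSpace ℝ (Fin d)) :
    ContMDiffAt 𝓘(ℝ, EuclideanSpace ℝ (Fin d)) ((𝓡 d).prod 𝓘(ℝ, EuclideanSpace ℝ (Fin d))) ∞
      (fun z => (TotalSpace.mk' (EuclideanSpace ℝ (Fin d)) ((extChartAt (𝓡 d) p).symm z)
        (mfderiv 𝓘(ℝ, EuclideanSpace ℝ (Fin d)) (𝓡 d) (extChartAt (𝓡 d) p).symm z u) :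
          TangentBundle (𝓡 d) N)) z := by
  have ho := isOpen_extChartAt_target (I := 𝓡 d) p
  have h := ContMDiffOn.contMDiffOn_tangentMapWithin (m := ∞)
    (contMDiffOn_extChartAt_symm (I := 𝓡 d) (n := ∞) p) (by simp) ho.uniqueMDiffOn
  have hc : ContMDiff 𝓘(ℝ, EuclideanSpace ℝ (Fin d)) (𝓘(ℝ, EuclideanSpace ℝ (Fin d)).tangent) ∞
      (fun z : EuclideanSpace ℝ (Fin d) =>
        (⟨z, u⟩ : TangentBundle 𝓘(ℝ, EuclideanSpace ℝ (Fin d)) (EuclideanSpace ℝ (Fin d)))) :=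
    contMDiff_vectorSpace_iff_contDiff.2 contDiff_const
  have h2 := (h.comp hc.contMDiffOn (s := (extChartAt (𝓡 d) p).target)
    (fun z hz => hz)).contMDiffAt (ho.mem_nhds hz)
  refine h2.congr_of_eventuallyEq ?_
  filter_upwards [ho.mem_nhds hz] with w hw
  simp only [Function.comp_apply, tangentMapWithin, mfderivWithin_of_isOpen ho hw]

theorem contDiffAt_metricInChart (g : SmoothMetric d N) {p : N} {z : EuclideanSpace ℝ (Fin d)}
    (hz : z ∈ (extChartAt (𝓡 d) p).target) :
    ContDiffAt ℝ ∞ (metricInChart g.inner p) z := by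
  refine contDiffAt_clm_apply_iff.2 fun u => contDiffAt_clm_apply_iff.2 fun v => ?_
  rw [← contMDiffAt_iff_contDiffAt]
  have h : ContMDiffAt 𝓘(ℝ, EuclideanSpace ℝ (Fin d)) ((𝓡 d).prod 𝓘(ℝ)) ∞
      (fun z => TotalSpace.mk' ℝ (E := Bundle.Trivial N ℝ) ((extChartAt (𝓡 d) p).symm z)
        (g.inner ((extChartAt (𝓡 d) p).symm z)
          (mfderiv 𝓘(ℝ, EuclideanSpace ℝ (Fin d)) (𝓡 d) (extChartAt (𝓡 d) p).symm z u)
          (mfderiv 𝓘(ℝ, EuclideanSpace ℝ (Fin d)) (𝓡 d) (extChartAt (𝓡 d) p).symm z v))) z := by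
    apply ContMDiffAt.clm_bundle_apply₂ (F₁ := EuclideanSpace ℝ (Fin d))
      (F₂ := EuclideanSpace ℝ (Fin d))
    · exact ContMDiffAt.comp z g.contMDiff.contMDiffAt (contMDiffAt_extChartAt_symm hz)
    · exact contMDiffAt_mfderiv_extChartAt_symm hz u
    · exact contMDiffAt_mfderiv_extChartAt_symm hz v
  rw [contMDiffAt_totalSpace] at h
  exact h.2

variable [IsManifold (𝓡 k) ∞ B]

/-- Near the base point, the metric induced by `f` is, in coordinates, the pullback of the ambient
metric by the coordinate expression of `f`. -/
theorem metricInChart_inducedMetric_eventually (G : MetricField d N) {f : B → N} {b : B}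
    (hf : ContMDiff (𝓡 k) (𝓡 d) ∞ f) :
    ∀ᶠ z in 𝓝 (extChartAt (𝓡 k) b b), ∀ u v, metricInChart (inducedMetric k G f) b z u v =
      metricInChart G (f b) (writtenInExtChartAt (𝓡 k) (𝓡 d) b f z)
        (fderiv ℝ (writtenInExtChartAt (𝓡 k) (𝓡 d) b f) z u)
        (fderiv ℝ (writtenInExtChartAt (𝓡 k) (𝓡 d) b f) z v) := by
  have hc : ContinuousAt (f ∘ (extChartAt (𝓡 k) b).symm) (extChartAt (𝓡 k) b b) :=
    hf.continuous.continuousAt.comp (continuousAt_extChartAt_symm b)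
  have hs : ∀ᶠ z in 𝓝 (extChartAt (𝓡 k) b b),
      f ((extChartAt (𝓡 k) b).symm z) ∈ (extChartAt (𝓡 d) (f b)).source := by
    refine hc.eventually_mem ?_
    rw [Function.comp_apply, extChartAt_to_inv]
    exact extChartAt_source_mem_nhds (f b)
  have hsm := ((contDiffAt_writtenInExtChartAt (hf.contMDiffAt (x := b))).of_le
    (m := 1) (by simp)).eventually (by simp)
  filter_upwards [extChartAt_target_mem_nhds (I := 𝓡 k) b, hs.eventually_nhds, hsm]
    with z hzt hzs hzd u v
  have hzs' := hzs.self_of_nhds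
  have hd1 : MDifferentiableAt 𝓘(ℝ, EuclideanSpace ℝ (Fin k)) (𝓡 k) (extChartAt (𝓡 k) b).symm z :=
    (contMDiffAt_extChartAt_symm hzt).mdifferentiableAt (by simp)
  have hd2 : MDifferentiableAt (𝓡 k) (𝓡 d) f ((extChartAt (𝓡 k) b).symm z) :=
    hf.contMDiffAt.mdifferentiableAt (by simp)
  have hd3 : MDifferentiableAt 𝓘(ℝ, EuclideanSpace ℝ (Fin k)) 𝓘(ℝ, EuclideanSpace ℝ (Fin d))
      (writtenInExtChartAt (𝓡 k) (𝓡 d) b f) z := hzd.contMDiffAt.mdifferentiableAt (by simp)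
  have hd4 : MDifferentiableAt 𝓘(ℝ, EuclideanSpace ℝ (Fin d)) (𝓡 d) (extChartAt (𝓡 d) (f b)).symm
      (writtenInExtChartAt (𝓡 k) (𝓡 d) b f z) :=
    (contMDiffAt_extChartAt_symm ((extChartAt (𝓡 d) (f b)).map_source hzs')).mdifferentiableAt
      (by simp)
  have he : (extChartAt (𝓡 d) (f b)).symm ∘ writtenInExtChartAt (𝓡 k) (𝓡 d) b f =ᶠ[𝓝 z]
      f ∘ (extChartAt (𝓡 k) b).symm :=
    hzs.mono fun w hw => (extChartAt (𝓡 d) (f b)).left_inv hw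
  have h := apply_mfderiv_congr G he u v
  rw [mfderiv_comp z hd4 hd3, mfderiv_comp z hd2 hd1, mfderiv_eq_fderiv] at h
  exact h.symm

theorem contDiffAt_metricInChart_inducedMetric (g : SmoothMetric d N) {f : B → N} {b : B}
    (hf : ContMDiff (𝓡 k) (𝓡 d) ∞ f) :
    ContDiffAt ℝ ∞ (metricInChart (inducedMetric k g.inner f) b) (extChartAt (𝓡 k) b b) := by
  have hF := contDiffAt_writtenInExtChartAt (hf.contMDiffAt (x := b))
  have hD := hF.fderiv_right (m := ∞) (by simp)
  have hb : writtenInExtChartAt (𝓡 k) (𝓡 d) b f (extChartAt (𝓡 k) b b) ∈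
      (extChartAt (𝓡 d) (f b)).target := by
    simp [writtenInExtChartAt]
  have hG := (contDiffAt_metricInChart g hb).comp _ hF
  refine contDiffAt_clm_apply_iff.2 fun u => contDiffAt_clm_apply_iff.2 fun v => ?_
  refine ((hG.clm_apply (hD.clm_apply (contDiffAt_const (c := u)))).clm_apply
    (hD.clm_apply (contDiffAt_const (c := v)))).congr_of_eventuallyEq ?_
  exact (metricInChart_inducedMetric_eventually g.inner hf).mono fun z hz => hz u v

theorem injective_metricInChart_inducedMetric (g : SmoothMetric d N) {f : B → N} {b : B}
    (hf : Function.Injective (mfderiv (𝓡 k) (𝓡 d) f b)) :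
    Function.Injective (metricInChart (inducedMetric k g.inner f) b (extChartAt (𝓡 k) b b)) := by
  refine (injective_iff_map_eq_zero _).2 fun u hu => ?_
  have h := metricInChart_apply (inducedMetric k g.inner f) b (extChartAt (𝓡 k) b b) u u
  rw [hu] at h
  have hb : (extChartAt (𝓡 k) b).symm (extChartAt (𝓡 k) b b) = b := extChartAt_to_inv b
  have h1 := eq_zero_of_inducedMetric_self g (by rw [hb]; exact hf) h.symm
  exact injective_mfderiv_extChartAt_symm (mem_extChartAt_target b) (h1.trans (map_zero _).symm)

end MetricInChart

/-! ### The second fundamental form as the normal part of the covariant Hessian -/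

section CoordHessian

variable {d k : ℕ} {N : Type*} [TopologicalSpace N] [ChartedSpace (EuclideanSpace ℝ (Fin d)) N]
  {B : Type*} [TopologicalSpace B] [ChartedSpace (EuclideanSpace ℝ (Fin k)) B]

/-- The coordinate expression `D²F(u, v) + Γ(DF u, DF v)` of the covariant derivative of `df(v)` in
the direction `u`, where `F` is the expression of `f` in the preferred charts. -/
def coordHessian (G : MetricField d N) (f : B → N) (b : B) (u v : EuclideanSpace ℝ (Fin k)) :
    EuclideanSpace ℝ (Fin d) :=
  let F := writtenInExtChartAt (𝓡 k) (𝓡 d) b f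
  let z := extChartAt (𝓡 k) b b
  fderiv ℝ (fderiv ℝ F) z u v +
    christoffel G (f b) (extChartAt (𝓡 d) (f b) (f b)) (fderiv ℝ F z u) (fderiv ℝ F z v)

theorem fderiv_apply_const {U V W : Type*} [NormedAddCommGroup U] [NormedSpace ℝ U]
    [NormedAddCommGroup V] [NormedSpace ℝ V] [NormedAddCommGroup W] [NormedSpace ℝ W]
    {L : U → V →L[ℝ] W} {z : U} (hL : DifferentiableAt ℝ L z) (v : V) (u : U) :
    fderiv ℝ (fun z => L z v) z u = fderiv ℝ L z u v := by
  rw [(hL.hasFDerivAt.clm_apply (hasFDerivAt_const v _)).fderiv]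
  simp

/-- `FiberBundle.extend` is constant in the trivialization at `b`, and that trivialization is the
differential of the chart; so the extension is a constant coordinate field, and differentiating it
adds no terms to the Hessian. -/
theorem mfderiv_extChartAt_extend [IsManifold (𝓡 k) ∞ B] {b b' : B} (v : TangentSpace (𝓡 k) b)
    (hb' : b' ∈ (chartAt (EuclideanSpace ℝ (Fin k)) b).source) :
    mfderiv (𝓡 k) 𝓘(ℝ, EuclideanSpace ℝ (Fin k)) (extChartAt (𝓡 k) b) b'
      (FiberBundle.extend (EuclideanSpace ℝ (Fin k)) v b') = v := by
  rw [← TangentBundle.continuousLinearMapAt_trivializationAt hb']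
  have h1 : ((trivializationAt (EuclideanSpace ℝ (Fin k)) (TangentSpace (𝓡 k)) b) ⟨b, v⟩).2 = v := by
    have h := TangentBundle.continuousLinearMapAt_trivializationAt (I := 𝓡 k)
      (mem_chart_source (EuclideanSpace ℝ (Fin k)) b)
    rw [mfderiv_extChartAt_self] at h
    have h2 := congrArg (fun L : EuclideanSpace ℝ (Fin k) →L[ℝ] EuclideanSpace ℝ (Fin k) => L v) h
    refine (congrFun (Bundle.Trivialization.coe_linearMapAt_of_mem (R := ℝ)
      (trivializationAt (EuclideanSpace ℝ (Fin k)) (TangentSpace (𝓡 k)) b)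
      (FiberBundle.mem_baseSet_trivializationAt' b)) v).symm.trans h2
  unfold FiberBundle.extend
  simp only [h1]
  have h2 := (trivializationAt (EuclideanSpace ℝ (Fin k)) (TangentSpace (𝓡 k))
    b).continuousLinearMapAt_symmL (R := ℝ) (b := b') (by simpa using hb') v
  have h3 := Bundle.Trivialization.symmL_apply (R := ℝ)
    (trivializationAt (EuclideanSpace ℝ (Fin k)) (TangentSpace (𝓡 k)) b) (b := b')
    (by simpa using hb') (v : EuclideanSpace ℝ (Fin k))
  exact (congrArg (Bundle.Trivialization.continuousLinearMapAt ℝ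
    (trivializationAt (EuclideanSpace ℝ (Fin k)) (TangentSpace (𝓡 k)) b) b') h3.symm).trans h2

variable [IsManifold (𝓡 d) ∞ N] [IsManifold (𝓡 k) ∞ B]

theorem mvfderiv_mfderiv_extend_eventually {f : B → N} {b : B}
    (hf : ContMDiff (𝓡 k) (𝓡 d) ∞ f) (v : TangentSpace (𝓡 k) b) :
    ∀ᶠ b' in 𝓝 b, mvfderiv (𝓡 d) (extChartAt (𝓡 d) (f b)) (f b')
        (mfderiv (𝓡 k) (𝓡 d) f b' (FiberBundle.extend (EuclideanSpace ℝ (Fin k)) v b')) =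
      fderiv ℝ (writtenInExtChartAt (𝓡 k) (𝓡 d) b f) (extChartAt (𝓡 k) b b') v := by
  have hs : ∀ᶠ b' in 𝓝 b, f b' ∈ (chartAt (EuclideanSpace ℝ (Fin d)) (f b)).source :=
    hf.continuous.continuousAt.eventually_mem (chart_source_mem_nhds _ (f b))
  have ht : ∀ᶠ b' in 𝓝 b, b' ∈ (chartAt (EuclideanSpace ℝ (Fin k)) b).source :=
    chart_source_mem_nhds _ b
  have hsm := (continuousAt_extChartAt (I := 𝓡 k) b).eventually
    (((contDiffAt_writtenInExtChartAt (hf.contMDiffAt (x := b))).of_le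
      (m := 1) (by simp)).eventually (by simp))
  filter_upwards [hs, ht.eventually_nhds, hsm] with b' hs' ht' hd
  have hd1 : MDifferentiableAt (𝓡 k) 𝓘(ℝ, EuclideanSpace ℝ (Fin k)) (extChartAt (𝓡 k) b) b' :=
    mdifferentiableAt_extChartAt ht'.self_of_nhds
  have hd2 : MDifferentiableAt (𝓡 k) (𝓡 d) f b' := hf.contMDiffAt.mdifferentiableAt (by simp)
  have hd3 : MDifferentiableAt (𝓡 d) 𝓘(ℝ, EuclideanSpace ℝ (Fin d)) (extChartAt (𝓡 d) (f b)) (f b') :=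
    mdifferentiableAt_extChartAt hs'
  have hd4 : MDifferentiableAt 𝓘(ℝ, EuclideanSpace ℝ (Fin k)) 𝓘(ℝ, EuclideanSpace ℝ (Fin d))
      (writtenInExtChartAt (𝓡 k) (𝓡 d) b f) (extChartAt (𝓡 k) b b') :=
    hd.contMDiffAt.mdifferentiableAt (by simp)
  have he : extChartAt (𝓡 d) (f b) ∘ f =ᶠ[𝓝 b']
      writtenInExtChartAt (𝓡 k) (𝓡 d) b f ∘ extChartAt (𝓡 k) b := by
    filter_upwards [ht'] with c hc
    simp only [Function.comp_apply, writtenInExtChartAt]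
    rw [(extChartAt (𝓡 k) b).left_inv (by simpa using hc)]
  have h := he.mfderiv_eq (I := 𝓡 k) (I' := 𝓘(ℝ, EuclideanSpace ℝ (Fin d)))
  rw [mfderiv_comp b' hd3 hd2, mfderiv_comp b' hd4 hd1, mfderiv_eq_fderiv] at h
  have h' := congrArg (fun L : EuclideanSpace ℝ (Fin k) →L[ℝ] EuclideanSpace ℝ (Fin d) =>
    L (FiberBundle.extend (EuclideanSpace ℝ (Fin k)) v b')) h
  refine h'.trans ?_
  exact congrArg (fderiv ℝ (writtenInExtChartAt (𝓡 k) (𝓡 d) b f) (extChartAt (𝓡 k) b b'))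
    (mfderiv_extChartAt_extend v ht'.self_of_nhds)

theorem covDerivAlong_mfderiv_extend (G : MetricField d N) {f : B → N} {b : B}
    (hf : ContMDiff (𝓡 k) (𝓡 d) ∞ f) (u v : TangentSpace (𝓡 k) b) :
    covDerivAlong k G f
        (fun b' => mfderiv (𝓡 k) (𝓡 d) f b' (FiberBundle.extend (EuclideanSpace ℝ (Fin k)) v b')) b u =
      coordHessian G f b u v := by
  have hF := contDiffAt_writtenInExtChartAt (hf.contMDiffAt (x := b))
  have h1 : mvfderiv (𝓡 k) (fun b' => mvfderiv (𝓡 d) (extChartAt (𝓡 d) (f b)) (f b')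
      (mfderiv (𝓡 k) (𝓡 d) f b' (FiberBundle.extend (EuclideanSpace ℝ (Fin k)) v b'))) b u =
      fderiv ℝ (fderiv ℝ (writtenInExtChartAt (𝓡 k) (𝓡 d) b f)) (extChartAt (𝓡 k) b b) u v := by
    have hd : DifferentiableAt ℝ (fderiv ℝ (writtenInExtChartAt (𝓡 k) (𝓡 d) b f))
        (extChartAt (𝓡 k) b b) :=
      (hF.fderiv_right (m := ∞) (by simp)).differentiableAt (by simp)
    have hd1 : MDifferentiableAt (𝓡 k) 𝓘(ℝ, EuclideanSpace ℝ (Fin k)) (extChartAt (𝓡 k) b) b :=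
      mdifferentiableAt_extChartAt (mem_chart_source _ b)
    have hd2 := hd.clm_apply (differentiableAt_const (c := (v : EuclideanSpace ℝ (Fin k))))
    have he : (fun b' => mvfderiv (𝓡 d) (extChartAt (𝓡 d) (f b)) (f b')
        (mfderiv (𝓡 k) (𝓡 d) f b' (FiberBundle.extend (EuclideanSpace ℝ (Fin k)) v b'))) =ᶠ[𝓝 b]
        (fun z => fderiv ℝ (writtenInExtChartAt (𝓡 k) (𝓡 d) b f) z
          (v : EuclideanSpace ℝ (Fin k))) ∘ extChartAt (𝓡 k) b :=
      mvfderiv_mfderiv_extend_eventually hf v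
    have h := he.mfderiv_eq (I := 𝓡 k) (I' := 𝓘(ℝ, EuclideanSpace ℝ (Fin d)))
    rw [mfderiv_comp b hd2.mdifferentiableAt hd1, mfderiv_eq_fderiv, mfderiv_extChartAt_self] at h
    have h' := congrArg (fun L : EuclideanSpace ℝ (Fin k) →L[ℝ] EuclideanSpace ℝ (Fin d) => L u) h
    refine h'.trans ?_
    exact fderiv_apply_const hd v u
  have h2 (w : TangentSpace (𝓡 k) b) : mvfderiv (𝓡 d) (extChartAt (𝓡 d) (f b)) (f b)
      (mfderiv (𝓡 k) (𝓡 d) f b w) =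
      fderiv ℝ (writtenInExtChartAt (𝓡 k) (𝓡 d) b f) (extChartAt (𝓡 k) b b) w := by
    rw [mvfderiv_extChartAt_self, mfderiv_eq_fderiv_writtenInExtChartAt hf.contMDiffAt]
    rfl
  have h3 := (congrArg (fun w => mvfderiv (𝓡 d) (extChartAt (𝓡 d) (f b)) (f b)
      (mfderiv (𝓡 k) (𝓡 d) f b w))
    (FiberBundle.extend_apply_self (F := EuclideanSpace ℝ (Fin k)) v)).trans (h2 v)
  refine (inverse_mvfderiv_extChartAt_self_apply _ _).trans ?_
  exact congrArg₂ (· + ·) h1 (congrArg₂ (christoffel G (f b) _) (h2 u) h3)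

theorem secondFundamentalForm_eq (G : MetricField d N) {f : B → N} {b : B}
    (hf : ContMDiff (𝓡 k) (𝓡 d) ∞ f) (u v : TangentSpace (𝓡 k) b) :
    secondFundamentalForm k G f b u v = normalPart k G f b (coordHessian G f b u v) :=
  congrArg (normalPart k G f b) (covDerivAlong_mfderiv_extend G hf u v)

end CoordHessian

theorem two_le_infty : (2 : WithTop ℕ∞) ≤ ∞ := by
  exact WithTop.coe_le_coe.2 (le_top : (2 : ℕ∞) ≤ ⊤)

/-! ### Regularity of integral curves and derivatives along curves -/

section Curves

variable {V W : Type*} [NormedAddCommGroup V] [NormedSpace ℝ V] [NormedAddCommGroup W]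
  [NormedSpace ℝ W]

/-- An integral curve of a vector field which is smooth at a point is smooth at that time. -/
theorem contDiffAt_of_hasDerivAt {h : V → V} {α : ℝ → V} {t₀ : ℝ}
    (hh : ContDiffAt ℝ ∞ h (α t₀)) (hα : ∀ᶠ t in 𝓝 t₀, HasDerivAt α (h (α t)) t) (n : ℕ) :
    ContDiffAt ℝ n α t₀ := by
  induction n with
  | zero =>
    rw [Nat.cast_zero, contDiffAt_zero]
    exact ⟨_, hα, fun t ht => (HasDerivAt.continuousAt ht).continuousWithinAt⟩
  | succ n ih =>
    rw [Nat.cast_succ, contDiffAt_succ_iff_hasFDerivAt]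
    refine ⟨fun t => ContinuousLinearMap.toSpanSingleton ℝ (h (α t)), ⟨_, hα, fun t ht => ?_⟩, ?_⟩
    · exact HasDerivAt.hasFDerivAt ht
    · have h1 : ContDiffAt ℝ n (fun t => h (α t)) t₀ :=
        ContDiffAt.comp t₀ (hh.of_le (by exact_mod_cast le_top)) ih
      exact ((ContinuousLinearMap.toSpanSingletonCLE (𝕜 := ℝ) (E := V)).contDiff.contDiffAt.comp
        t₀ h1)

theorem deriv_comp_eventually {F : V → W} {e : ℝ → V} {t₀ : ℝ} (hF : ContDiffAt ℝ ∞ F (e t₀))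
    (he : ContDiffAt ℝ 2 e t₀) :
    deriv (F ∘ e) =ᶠ[𝓝 t₀] fun t => fderiv ℝ F (e t) (deriv e t) := by
  have h1 := (he.continuousAt).eventually ((hF.of_le (m := 1) (by simp)).eventually (by simp))
  have h2 := (he.of_le (m := 1) (by norm_num)).eventually (by simp)
  filter_upwards [h1, h2] with t ht1 ht2
  exact fderiv_comp_deriv t (ht1.differentiableAt (by simp)) (ht2.differentiableAt (by simp))

theorem deriv_deriv_comp {F : V → W} {e : ℝ → V} {t₀ : ℝ} (hF : ContDiffAt ℝ ∞ F (e t₀))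
    (he : ContDiffAt ℝ 2 e t₀) :
    deriv (deriv (F ∘ e)) t₀ = fderiv ℝ (fderiv ℝ F) (e t₀) (deriv e t₀) (deriv e t₀) +
      fderiv ℝ F (e t₀) (deriv (deriv e) t₀) := by
  rw [(deriv_comp_eventually hF he).deriv_eq]
  have hF' : HasFDerivAt (fderiv ℝ F) (fderiv ℝ (fderiv ℝ F) (e t₀)) (e t₀) :=
    ((hF.fderiv_right (m := ∞) (by simp)).differentiableAt (by simp)).hasFDerivAt
  have he' : HasDerivAt e (deriv e t₀) t₀ := (he.differentiableAt (by simp)).hasDerivAt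
  have he2 : HasDerivAt (deriv e) (deriv (deriv e) t₀) t₀ := by
    have h : DifferentiableAt ℝ (fderiv ℝ e) t₀ :=
      (he.fderiv_right (m := 1) (by norm_num)).differentiableAt (by simp)
    exact (h.clm_apply (differentiableAt_const (1 : ℝ))).hasDerivAt
  exact ((hF'.comp_hasDerivAt t₀ he').clm_apply he2).deriv

end Curves

/-! ### Geodesics and the Hessian of a totally geodesic immersion -/

section Geodesic

variable {d k : ℕ} {N : Type*} [TopologicalSpace N] [ChartedSpace (EuclideanSpace ℝ (Fin d)) N]
  {B : Type*} [TopologicalSpace B] [ChartedSpace (EuclideanSpace ℝ (Fin k)) B]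
  [IsManifold (𝓡 k) ∞ B]

/-- Existence of the geodesic with a given initial velocity, for a metric which is smooth and
nondegenerate at the initial point. The curve is given by its coordinate expression `e`. -/
theorem exists_isGeodesicAt {G : MetricField k B} {b : B}
    (hG : ContDiffAt ℝ ∞ (metricInChart G b) (extChartAt (𝓡 k) b b))
    (hi : Function.Injective (metricInChart G b (extChartAt (𝓡 k) b b)))
    (v : EuclideanSpace ℝ (Fin k)) :
    ∃ e : ℝ → EuclideanSpace ℝ (Fin k), ContDiffAt ℝ 2 e 0 ∧ e 0 = extChartAt (𝓡 k) b b ∧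
      deriv e 0 = v ∧ IsGeodesicAt G ((extChartAt (𝓡 k) b).symm ∘ e) 0 := by
  have hΓ := contDiffAt_christoffel hG hi v
  -- The geodesic equation as a first-order system for position and velocity.
  have hh : ContDiffAt ℝ ∞ (fun w : EuclideanSpace ℝ (Fin k) × EuclideanSpace ℝ (Fin k) =>
      (w.2, -christoffel G b w.1 w.2 w.2)) (extChartAt (𝓡 k) b b, v) :=
    contDiffAt_snd.prodMk hΓ.neg
  obtain ⟨α, hα0, ε, hε, hα⟩ :=
    (hh.of_le (m := 1) (by simp)).exists_forall_mem_closedBall_exists_eq_forall_mem_Ioo_hasDerivAt₀ 0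
  have hα' : ∀ᶠ t in 𝓝 (0 : ℝ), HasDerivAt α
      ((α t).2, -christoffel G b (α t).1 (α t).2 (α t).2) t :=
    Filter.mem_of_superset (Ioo_mem_nhds (by linarith) (by linarith)) hα
  -- Picard–Lindelöf only yields a differentiable curve; bootstrapping the equation supplies the C²
  -- regularity that `IsGeodesicAt` demands.
  have hsm : ContDiffAt ℝ 2 α 0 := contDiffAt_of_hasDerivAt (by rw [hα0]; exact hh) hα' 2
  have he : ContDiffAt ℝ 2 (fun t => (α t).1) 0 := contDiffAt_fst.comp (0 : ℝ) hsm
  have h1 : deriv (fun t => (α t).1) =ᶠ[𝓝 0] fun t => (α t).2 :=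
    hα'.mono fun t ht => ((hasFDerivAt_fst (𝕜 := ℝ) (p := α t)).comp_hasDerivAt t ht).deriv
  have h2 : deriv (fun t => (α t).2) =ᶠ[𝓝 0] fun t => -christoffel G b (α t).1 (α t).2 (α t).2 :=
    hα'.mono fun t ht => ((hasFDerivAt_snd (𝕜 := ℝ) (p := α t)).comp_hasDerivAt t ht).deriv
  have h0 : (extChartAt (𝓡 k) b).symm (α 0).1 = b := by rw [hα0]; exact extChartAt_to_inv b
  have ht : (α 0).1 ∈ (extChartAt (𝓡 k) b).target := by
    rw [hα0]; exact mem_extChartAt_target b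
  refine ⟨fun t => (α t).1, he, congrArg Prod.fst hα0, by rw [h1.eq_of_nhds, hα0], ?_, ?_⟩
  · exact ((contMDiffAt_extChartAt_symm ht).of_le two_le_infty).comp (0 : ℝ) he.contMDiffAt
  · have hc : (fun t => extChartAt (𝓡 k) b ((extChartAt (𝓡 k) b).symm (α t).1)) =ᶠ[𝓝 0]
        fun t => (α t).1 :=
      (he.continuousAt.eventually_mem ((isOpen_extChartAt_target b).mem_nhds ht)).mono
        fun t ht => (extChartAt (𝓡 k) b).right_inv ht
    simp only [Function.comp_apply, h0]
    filter_upwards [hc, hc.deriv, hc.deriv.deriv, h1, h1.deriv, h2] with t hc0 hc1 hc2 h1 h1' h2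
    rw [hc2, hc1, hc0, h1', h1, h2, neg_add_cancel]

variable [IsManifold (𝓡 d) ∞ N]

/-- Let `e` be a geodesic of the induced metric with velocity `v`, and F the expression of `f`. The
ambient geodesic equation for F ∘ e at time 0 reads Hess f(v, v) + DF(e''(0)) = 0. -/
theorem coordHessian_self_mem_range (g : SmoothMetric d N) {f : B → N}
    (hf : IsSmoothImmersion d k f) {b : B} (hgeo : IsTotallyGeodesicAt k g.inner f b)
    (v : EuclideanSpace ℝ (Fin k)) :
    ∃ a : EuclideanSpace ℝ (Fin k), coordHessian g.inner f b v v =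
      fderiv ℝ (writtenInExtChartAt (𝓡 k) (𝓡 d) b f) (extChartAt (𝓡 k) b b) a := by
  obtain ⟨e, he, he0, he1, hgeod⟩ := exists_isGeodesicAt
    (contDiffAt_metricInChart_inducedMetric g hf.1)
    (injective_metricInChart_inducedMetric g (hf.2 b)) v
  have hγ0 : (extChartAt (𝓡 k) b).symm (e 0) = b := by rw [he0]; exact extChartAt_to_inv b
  have h := (hgeo _ hγ0 hgeod).2.self_of_nhds
  have hF : ContDiffAt ℝ ∞ (writtenInExtChartAt (𝓡 k) (𝓡 d) b f) (e 0) := by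
    rw [he0]; exact contDiffAt_writtenInExtChartAt hf.1.contMDiffAt
  have hc : (fun t => extChartAt (𝓡 d) (f b) (f ((extChartAt (𝓡 k) b).symm (e t)))) =
      writtenInExtChartAt (𝓡 k) (𝓡 d) b f ∘ e := rfl
  simp only [Function.comp_apply, hγ0] at h
  rw [hc, deriv_deriv_comp hF he, (deriv_comp_eventually hF he).eq_of_nhds, he1, he0] at h
  refine ⟨-deriv (deriv e) 0, ?_⟩
  rw [map_neg, eq_neg_iff_add_eq_zero, ← h, coordHessian]
  abel

/-- The mixed terms combine because D²F is symmetric and the connection is torsion-free. -/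
theorem coordHessian_add_self (g : SmoothMetric d N) {f : B → N} {b : B}
    (hf : ContMDiffAt (𝓡 k) (𝓡 d) ∞ f b) (u v : EuclideanSpace ℝ (Fin k)) :
    coordHessian g.inner f b (u + v) (u + v) = coordHessian g.inner f b u u +
      (2 : ℝ) • coordHessian g.inner f b u v + coordHessian g.inner f b v v := by
  have hs : fderiv ℝ (fderiv ℝ (writtenInExtChartAt (𝓡 k) (𝓡 d) b f)) (extChartAt (𝓡 k) b b) v u =
      fderiv ℝ (fderiv ℝ (writtenInExtChartAt (𝓡 k) (𝓡 d) b f)) (extChartAt (𝓡 k) b b) u v :=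
    ((contDiffAt_writtenInExtChartAt hf).isSymmSndFDerivAt (by simpa using two_le_infty)) v u
  simp only [coordHessian, map_add, add_apply, christoffel_add_self, hs, two_smul]
  abel

/-- The second fundamental form of an immersion which is totally geodesic at `b` vanishes
at `b`. -/
theorem coordHessian_mem_range (g : SmoothMetric d N) {f : B → N}
    (hf : IsSmoothImmersion d k f) {b : B} (hgeo : IsTotallyGeodesicAt k g.inner f b)
    (u v : EuclideanSpace ℝ (Fin k)) :
    ∃ a : EuclideanSpace ℝ (Fin k), coordHessian g.inner f b u v =
      fderiv ℝ (writtenInExtChartAt (𝓡 k) (𝓡 d) b f) (extChartAt (𝓡 k) b b) a := by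
  obtain ⟨a₁, h₁⟩ := coordHessian_self_mem_range g hf hgeo (u + v)
  obtain ⟨a₂, h₂⟩ := coordHessian_self_mem_range g hf hgeo u
  obtain ⟨a₃, h₃⟩ := coordHessian_self_mem_range g hf hgeo v
  -- Polarization: 2 Hess(u, v) = Hess(u + v, u + v) - Hess(u, u) - Hess(v, v).
  refine ⟨(2⁻¹ : ℝ) • (a₁ - a₂ - a₃), ?_⟩
  rw [map_smul, map_sub, map_sub, ← h₁, ← h₂, ← h₃, coordHessian_add_self g hf.1.contMDiffAt,
    eq_inv_smul_iff₀ two_ne_zero]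
  abel

end Geodesic

/-! ### Second-order chain rule and intersection of ranges -/

theorem fderiv_fderiv_comp {U V W : Type*} [NormedAddCommGroup U] [NormedSpace ℝ U]
    [NormedAddCommGroup V] [NormedSpace ℝ V] [NormedAddCommGroup W] [NormedSpace ℝ W]
    {F : V → W} {A : U → V} {z : U} (hF : ContDiffAt ℝ ∞ F (A z)) (hA : ContDiffAt ℝ ∞ A z)
    (u v : U) :
    fderiv ℝ (fderiv ℝ (F ∘ A)) z u v =
      fderiv ℝ (fderiv ℝ F) (A z) (fderiv ℝ A z u) (fderiv ℝ A z v) +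
        fderiv ℝ F (A z) (fderiv ℝ (fderiv ℝ A) z u v) := by
  have h1 := hA.continuousAt.eventually ((hF.of_le (m := 1) (by simp)).eventually (by simp))
  have h2 := (hA.of_le (m := 1) (by simp)).eventually (by simp)
  have he : fderiv ℝ (F ∘ A) =ᶠ[𝓝 z] fun w => (fderiv ℝ F (A w)).comp (fderiv ℝ A w) := by
    filter_upwards [h1, h2] with w hw1 hw2
    exact fderiv_comp w (hw1.differentiableAt (by simp)) (hw2.differentiableAt (by simp))
  have hF' : HasFDerivAt (fderiv ℝ F) (fderiv ℝ (fderiv ℝ F) (A z)) (A z) :=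
    ((hF.fderiv_right (m := ∞) (by simp)).differentiableAt (by simp)).hasFDerivAt
  have hA' : HasFDerivAt (fderiv ℝ A) (fderiv ℝ (fderiv ℝ A) z) z :=
    ((hA.fderiv_right (m := ∞) (by simp)).differentiableAt (by simp)).hasFDerivAt
  have h := ((hF'.comp z (hA.differentiableAt (by simp)).hasFDerivAt).clm_comp hA').fderiv
  rw [he.fderiv_eq]
  refine (congrArg (fun L : U →L[ℝ] U →L[ℝ] W => L u v) h).trans ?_
  simp [add_comm]

/-- Since the ranges span, the intersection has dimension dim E₁ + dim E₂ - dim E = dim E₃, that of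
the subspace it contains. -/
theorem range_inf_range_le {E₁ E₂ E₃ E : Type*} [AddCommGroup E₁] [Module ℝ E₁]
    [AddCommGroup E₂] [Module ℝ E₂] [AddCommGroup E₃] [Module ℝ E₃] [AddCommGroup E] [Module ℝ E]
    [FiniteDimensional ℝ E₁] [FiniteDimensional ℝ E₂] [FiniteDimensional ℝ E₃]
    [FiniteDimensional ℝ E]
    {L₁ : E₁ →ₗ[ℝ] E} {L₂ : E₂ →ₗ[ℝ] E} {L₃ : E₃ →ₗ[ℝ] E} (h₁ : Function.Injective L₁)
    (h₂ : Function.Injective L₂) (h₃ : Function.Injective L₃)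
    (h : L₃.range ≤ L₁.range ⊓ L₂.range) (htop : L₁.range ⊔ L₂.range = ⊤)
    (hd : Module.finrank ℝ E₁ + Module.finrank ℝ E₂ = Module.finrank ℝ E + Module.finrank ℝ E₃) :
    L₁.range ⊓ L₂.range ≤ L₃.range := by
  have hs := Submodule.finrank_sup_add_finrank_inf_eq L₁.range L₂.range
  rw [htop, finrank_top, LinearMap.finrank_range_of_inj h₁, LinearMap.finrank_range_of_inj h₂] at hs
  refine (Submodule.eq_of_le_of_finrank_le h ?_).ge
  rw [LinearMap.finrank_range_of_inj h₃]
  omega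

section Composition

variable {d m s : ℕ} {N : Type*} [TopologicalSpace N] [ChartedSpace (EuclideanSpace ℝ (Fin d)) N]
  {A : Type*} [TopologicalSpace A] [ChartedSpace (EuclideanSpace ℝ (Fin m)) A]
  {S : Type*} [TopologicalSpace S] [ChartedSpace (EuclideanSpace ℝ (Fin s)) S]

/-- The composition formula for the covariant Hessian. -/
theorem coordHessian_comp (G : MetricField d N) {x : A → N} {α : S → A} {o : S}
    (hx : ContMDiffAt (𝓡 m) (𝓡 d) ∞ x (α o)) (hα : ContMDiffAt (𝓡 s) (𝓡 m) ∞ α o)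
    (u v : EuclideanSpace ℝ (Fin s)) :
    coordHessian G (x ∘ α) o u v =
      coordHessian G x (α o)
        (fderiv ℝ (writtenInExtChartAt (𝓡 s) (𝓡 m) o α) (extChartAt (𝓡 s) o o) u)
        (fderiv ℝ (writtenInExtChartAt (𝓡 s) (𝓡 m) o α) (extChartAt (𝓡 s) o o) v) +
      fderiv ℝ (writtenInExtChartAt (𝓡 m) (𝓡 d) (α o) x) (extChartAt (𝓡 m) (α o) (α o))
        (fderiv ℝ (fderiv ℝ (writtenInExtChartAt (𝓡 s) (𝓡 m) o α)) (extChartAt (𝓡 s) o o) u v) := by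
  have hX := contDiffAt_writtenInExtChartAt hx
  have hA := contDiffAt_writtenInExtChartAt hα
  have hz : writtenInExtChartAt (𝓡 s) (𝓡 m) o α (extChartAt (𝓡 s) o o) =
      extChartAt (𝓡 m) (α o) (α o) := by simp [writtenInExtChartAt]
  have he : writtenInExtChartAt (𝓡 s) (𝓡 d) o (x ∘ α) =ᶠ[𝓝 (extChartAt (𝓡 s) o o)]
      writtenInExtChartAt (𝓡 m) (𝓡 d) (α o) x ∘ writtenInExtChartAt (𝓡 s) (𝓡 m) o α := by
    have hc : ContinuousAt (α ∘ (extChartAt (𝓡 s) o).symm) (extChartAt (𝓡 s) o o) :=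
      ContinuousAt.comp (by rw [extChartAt_to_inv]; exact hα.continuousAt)
        (continuousAt_extChartAt_symm o)
    have hm : ∀ᶠ z in 𝓝 (extChartAt (𝓡 s) o o),
        α ((extChartAt (𝓡 s) o).symm z) ∈ (extChartAt (𝓡 m) (α o)).source := by
      refine hc.eventually_mem ?_
      rw [Function.comp_apply, extChartAt_to_inv]
      exact extChartAt_source_mem_nhds (α o)
    filter_upwards [hm] with z hz
    simp only [writtenInExtChartAt, Function.comp_apply, (extChartAt (𝓡 m) (α o)).left_inv hz]
  rw [← hz] at hX
  have h1 := fderiv_fderiv_comp hX hA u v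
  have h2 (w : EuclideanSpace ℝ (Fin s)) :
      fderiv ℝ (writtenInExtChartAt (𝓡 s) (𝓡 d) o (x ∘ α)) (extChartAt (𝓡 s) o o) w =
        fderiv ℝ (writtenInExtChartAt (𝓡 m) (𝓡 d) (α o) x) (extChartAt (𝓡 m) (α o) (α o))
          (fderiv ℝ (writtenInExtChartAt (𝓡 s) (𝓡 m) o α) (extChartAt (𝓡 s) o o) w) := by
    rw [he.fderiv_eq, fderiv_comp _ (hX.differentiableAt (by simp)) (hA.differentiableAt (by simp)),
      hz]
    rfl
  rw [hz] at h1
  simp only [coordHessian, h2, he.fderiv.fderiv_eq, h1, Function.comp_apply]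
  abel

theorem exists_coordHessian_comp_eq (G : MetricField d N) {x : A → N} {α : S → A} {o : S}
    (hx : ContMDiffAt (𝓡 m) (𝓡 d) ∞ x (α o)) (hα : ContMDiffAt (𝓡 s) (𝓡 m) ∞ α o)
    {Lx : EuclideanSpace ℝ (Fin m) →L[ℝ] EuclideanSpace ℝ (Fin d)}
    {Lα : EuclideanSpace ℝ (Fin s) →L[ℝ] EuclideanSpace ℝ (Fin m)}
    (hLx : Lx = mfderiv (𝓡 m) (𝓡 d) x (α o)) (hLα : Lα = mfderiv (𝓡 s) (𝓡 m) α o)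
    (u v : EuclideanSpace ℝ (Fin s)) :
    ∃ a, coordHessian G (x ∘ α) o u v = coordHessian G x (α o) (Lα u) (Lα v) + Lx a := by
  rw [hLx.trans (mfderiv_eq_fderiv_writtenInExtChartAt hx),
    hLα.trans (mfderiv_eq_fderiv_writtenInExtChartAt hα)]
  exact ⟨_, coordHessian_comp G hx hα u v⟩

end Composition

/-! ### The mean curvature vector of a transverse intersection -/

section Intersection

variable {d m l s : ℕ} {N : Type*} [TopologicalSpace N]
  [ChartedSpace (EuclideanSpace ℝ (Fin d)) N] [IsManifold (𝓡 d) ∞ N]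
  {Sig : Type*} [TopologicalSpace Sig] [ChartedSpace (EuclideanSpace ℝ (Fin m)) Sig]
  [IsManifold (𝓡 m) ∞ Sig]
  {M : Type*} [TopologicalSpace M] [ChartedSpace (EuclideanSpace ℝ (Fin l)) M]
  [IsManifold (𝓡 l) ∞ M]

/-- If the range of `dy` contains the normal space of `x`, the two immersions are transverse. -/
theorem range_sup_range_eq_top (g : SmoothMetric d N) {x : Sig → N} {y : M → N} {q : Sig} {p : M}
    (hx : Function.Injective (mfderiv (𝓡 m) (𝓡 d) x q))
    (hnormal : ∀ w ∈ normalSpace m g.inner x q, ∃ v : TangentSpace (𝓡 l) p,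
      (mfderiv (𝓡 l) (𝓡 d) y p v : EuclideanSpace ℝ (Fin d)) = w) :
    (mfderiv (𝓡 m) (𝓡 d) x q :
        EuclideanSpace ℝ (Fin m) →L[ℝ] EuclideanSpace ℝ (Fin d)).range ⊔
      (mfderiv (𝓡 l) (𝓡 d) y p :
        EuclideanSpace ℝ (Fin l) →L[ℝ] EuclideanSpace ℝ (Fin d)).range = ⊤ := by
  refine eq_top_iff.2 fun w _ => ?_
  obtain ⟨v, hv⟩ := hnormal _ (normalPart_mem g hx w)
  obtain ⟨u, hu⟩ := exists_mfderiv_add_normalPart (k := m) g.inner x q w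
  let L : EuclideanSpace ℝ (Fin m) →L[ℝ] EuclideanSpace ℝ (Fin d) := mfderiv (𝓡 m) (𝓡 d) x q
  exact Submodule.mem_sup.2 ⟨_, ⟨u, rfl⟩, _, ⟨v, rfl⟩, 
    (congrArg (fun z : EuclideanSpace ℝ (Fin d) => L u + z) hv).trans hu⟩

variable {S : Type*} [TopologicalSpace S] [ChartedSpace (EuclideanSpace ℝ (Fin s)) S]
  [IsManifold (𝓡 s) ∞ S]

/-- The geometric core: the Hessian of the composite, less the metric multiple of H, is tangent to
both immersions, hence to their intersection. -/
theorem meanCurvatureVector_comp_eq (g : SmoothMetric d N) {x : Sig → N} {y : M → N}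
    {α : S → Sig} {β : S → M} {o : S} (hs : 0 < s) (hd : m + l = d + s)
    (hx : IsSmoothImmersion d m x) (hy : IsSmoothImmersion d l y)
    (hα : ContMDiff (𝓡 s) (𝓡 m) ∞ α) (hβ : ContMDiff (𝓡 s) (𝓡 l) ∞ β) (h : x ∘ α = y ∘ β)
    (hi : IsSmoothImmersion d s (x ∘ α))
    (hq : IsUmbilicAt m g.inner x (α o)) (hgeo : IsTotallyGeodesicAt l g.inner y (β o))
    (hnormal : ∀ w ∈ normalSpace m g.inner x (α o), ∃ v : TangentSpace (𝓡 l) (β o),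
      (mfderiv (𝓡 l) (𝓡 d) y (β o) v : EuclideanSpace ℝ (Fin d)) = w) :
    meanCurvatureVector s g.inner (x ∘ α) o = meanCurvatureVector m g.inner x (α o) := by
  have hxd : MDifferentiableAt (𝓡 m) (𝓡 d) x (α o) := hx.1.mdifferentiable (by simp) _
  have hyd : MDifferentiableAt (𝓡 l) (𝓡 d) y (β o) := hy.1.mdifferentiable (by simp) _
  have hαd : MDifferentiableAt (𝓡 s) (𝓡 m) α o := hα.mdifferentiable (by simp) _
  have hβd : MDifferentiableAt (𝓡 s) (𝓡 l) β o := hβ.mdifferentiable (by simp) _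
  let Lx : EuclideanSpace ℝ (Fin m) →L[ℝ] EuclideanSpace ℝ (Fin d) := mfderiv (𝓡 m) (𝓡 d) x (α o)
  let Ly : EuclideanSpace ℝ (Fin l) →L[ℝ] EuclideanSpace ℝ (Fin d) := mfderiv (𝓡 l) (𝓡 d) y (β o)
  let Lα : EuclideanSpace ℝ (Fin s) →L[ℝ] EuclideanSpace ℝ (Fin m) := mfderiv (𝓡 s) (𝓡 m) α o
  let Lβ : EuclideanSpace ℝ (Fin s) →L[ℝ] EuclideanSpace ℝ (Fin l) := mfderiv (𝓡 s) (𝓡 l) β o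
  let L : EuclideanSpace ℝ (Fin s) →L[ℝ] EuclideanSpace ℝ (Fin d) := mfderiv (𝓡 s) (𝓡 d) (x ∘ α) o
  let H : EuclideanSpace ℝ (Fin d) := meanCurvatureVector m g.inner x (α o)
  have hL1 : L = Lx.comp Lα := mfderiv_comp o hxd hαd
  have hL2 : L = Ly.comp Lβ := by
    -- The type of the differential depends on the map, so the equation `x ∘ α = y ∘ β` is used by
    -- substitution for a variable map.
    have (f : S → N) (hf : f = y ∘ β) : (mfderiv (𝓡 s) (𝓡 d) f o :
        EuclideanSpace ℝ (Fin s) →L[ℝ] EuclideanSpace ℝ (Fin d)) = Ly.comp Lβ := by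
      subst hf
      exact mfderiv_comp o hyd hβd
    exact this _ h
  have hrange : Lx.range ⊓ Ly.range ≤ L.range := by
    refine range_inf_range_le (hx.2 _) (hy.2 _) (hi.2 o) ?_
      (range_sup_range_eq_top g (hx.2 _) hnormal) (by simpa using hd)
    rintro _ ⟨a, rfl⟩
    exact ⟨⟨Lα a, by rw [hL1]; rfl⟩, ⟨Lβ a, by rw [hL2]; rfl⟩⟩
  have hH : H ∈ normalSpace m g.inner x (α o) := meanCurvatureVector_mem g (hx.2 _)
  have hH' : H ∈ normalSpace s g.inner (x ∘ α) o := fun u =>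
    (congrArg (fun w => g.inner (x (α o)) w H)
      (congrArg (fun L : EuclideanSpace ℝ (Fin s) →L[ℝ] EuclideanSpace ℝ (Fin d) => L u) hL1)).trans
      (hH (Lα u))
  have key (u v : EuclideanSpace ℝ (Fin s)) : ∃ a, coordHessian g.inner (x ∘ α) o u v =
      L a + inducedMetric s g.inner (x ∘ α) o u v • H := by
    have hc : inducedMetric m g.inner x (α o) (Lα u) (Lα v) =
        inducedMetric s g.inner (x ∘ α) o u v :=
      (congrArg₂ (fun w w' : EuclideanSpace ℝ (Fin d) => g.inner (x (α o)) w w')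
        (congrArg (fun L : EuclideanSpace ℝ (Fin s) →L[ℝ] EuclideanSpace ℝ (Fin d) => L u) hL1)
        (congrArg (fun L : EuclideanSpace ℝ (Fin s) →L[ℝ] EuclideanSpace ℝ (Fin d) => L v) hL1)).symm
    generalize inducedMetric s g.inner (x ∘ α) o u v = c at hc
    obtain ⟨a, ha⟩ : coordHessian g.inner (x ∘ α) o u v - c • H ∈ L.range := by
      refine hrange ⟨?_, ?_⟩
      -- Tangent to x: `a₁` comes from the second derivative of `α`, `a₂` from the tangential part
      -- of Hess x; umbilicity identifies the normal part.
      · obtain ⟨a₁, h₁⟩ :=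
          exists_coordHessian_comp_eq g.inner hx.1.contMDiffAt hα.contMDiffAt (Lx := Lx) rfl
            (Lα := Lα) rfl u v
        obtain ⟨a₂, h₂⟩ : ∃ a, Lx a + c • H = coordHessian g.inner x (α o) (Lα u) (Lα v) := by
          obtain ⟨a, ha⟩ := exists_mfderiv_add_normalPart (k := m) g.inner x (α o)
            (coordHessian g.inner x (α o) (Lα u) (Lα v))
          have h3 := (secondFundamentalForm_eq g.inner hx.1 (Lα u) (Lα v)).symm.trans
            ((hq (Lα u) (Lα v)).trans (congrArg (· • H) hc))
          exact ⟨a, (congrArg (Lx a + ·) h3).symm.trans ha⟩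
        refine ⟨a₁ + a₂, ?_⟩
        rw [h₁, ← h₂]
        simp only [ContinuousLinearMap.coe_coe, map_add]
        abel
      -- Tangent to y: H is normal to x, so `hnormal` applies to it, and total geodesy handles the
      -- Hessian.
      · refine Submodule.sub_mem _ ?_ (Submodule.smul_mem _ _ (hnormal _ hH))
        obtain ⟨a₁, h₁⟩ :=
          exists_coordHessian_comp_eq g.inner hy.1.contMDiffAt hβ.contMDiffAt (Lx := Ly) rfl
            (Lα := Lβ) rfl u v
        obtain ⟨a₂, h₂⟩ := coordHessian_mem_range g hy hgeo (Lβ u) (Lβ v)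
        have hLy := mfderiv_eq_fderiv_writtenInExtChartAt (hy.1.contMDiffAt (x := β o))
        rw [h, h₁, h₂]
        refine ⟨a₂ + a₁, (map_add Ly a₂ a₁).trans (congrArg (· + Ly a₁) ?_)⟩
        exact congrArg (fun L : EuclideanSpace ℝ (Fin l) →L[ℝ] EuclideanSpace ℝ (Fin d) => L a₂) hLy
    exact ⟨a, by rw [← sub_eq_iff_eq_add]; exact ha.symm⟩
  refine meanCurvatureVector_eq_of_secondFundamentalForm_eq g hs (hi.2 o) fun u v => ?_
  obtain ⟨a, ha⟩ := key u v
  exact (secondFundamentalForm_eq g.inner hi.1 u v).trans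
    ((congrArg (normalPart s g.inner (x ∘ α) o) ha).trans
      (normalPart_add g (hi.2 o) a (Submodule.smul_mem _ _ hH')))

end Intersection

/-! ### Local normal form of a submersion -/

section LocalModel

variable {W V T : Type*} [NormedAddCommGroup W] [NormedSpace ℝ W] [FiniteDimensional ℝ W]
  [NormedAddCommGroup V] [NormedSpace ℝ V] [FiniteDimensional ℝ V]
  [NormedAddCommGroup T] [NormedSpace ℝ T] [FiniteDimensional ℝ T]

/-- Take for `P` a linear retraction onto the kernel of `L`, identified with `T` by dimension: it is
injective exactly where `L` loses information. -/
theorem exists_injective_prod {L : W →L[ℝ] V} (hL : Function.Surjective L)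
    (hd : Module.finrank ℝ W = Module.finrank ℝ V + Module.finrank ℝ T) :
    ∃ P : W →L[ℝ] T, Function.Injective (L.prod P) := by
  have hk : Module.finrank ℝ (L : W →ₗ[ℝ] V).ker = Module.finrank ℝ T := by
    have h := (L : W →ₗ[ℝ] V).finrank_range_add_finrank_ker
    rw [LinearMap.range_eq_top.2 hL, finrank_top] at h
    omega
  obtain ⟨r, hr⟩ := (L : W →ₗ[ℝ] V).ker.subtype.exists_leftInverse_of_injective
    (Submodule.ker_subtype _)
  let e := LinearEquiv.ofFinrankEq _ _ hk
  refine ⟨(e.toLinearMap ∘ₗ r).toContinuousLinearMap, (injective_iff_map_eq_zero _).2 fun w hw => ?_⟩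
  have h1 : L w = 0 := congrArg Prod.fst hw
  have h2 : e (r w) = 0 := congrArg Prod.snd hw
  have h3 : r w = ⟨w, h1⟩ := LinearMap.congr_fun hr ⟨w, h1⟩
  rw [LinearEquiv.map_eq_zero_iff, h3] at h2
  exact congrArg Subtype.val h2

/-- A smooth map with surjective differential is, in suitable smooth local coordinates, the first
projection. -/
theorem exists_openPartialHomeomorph_fst_eq {F : W → V} {U : Set W} (hU : IsOpen U)
    (hF : ∀ w ∈ U, ContDiffAt ℝ ∞ F w) {w₀ : W} (hw₀ : w₀ ∈ U)
    (hs : Function.Surjective (fderiv ℝ F w₀))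
    (hd : Module.finrank ℝ W = Module.finrank ℝ V + Module.finrank ℝ T) :
    ∃ Φ : OpenPartialHomeomorph W (V × T), w₀ ∈ Φ.source ∧ Φ.source ⊆ U ∧
      (∀ w, (Φ w).1 = F w) ∧ (∀ w ∈ Φ.source, ContDiffAt ℝ ∞ Φ w) ∧
      ∀ z ∈ Φ.target, ContDiffAt ℝ ∞ Φ.symm z := by
  obtain ⟨P, hP⟩ := exists_injective_prod (T := T) hs hd
  let f : W → V × T := fun w => (F w, P w)
  have hf (w : W) (hw : w ∈ U) : ContDiffAt ℝ ∞ f w := (hF w hw).prodMk P.contDiff.contDiffAt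
  have hf' (w : W) (hw : w ∈ U) : HasFDerivAt f ((fderiv ℝ F w).prod P) w :=
    ((hF w hw).differentiableAt (by simp)).hasFDerivAt.prodMk P.hasFDerivAt
  let D : W → W →L[ℝ] V × T := fun w => (fderiv ℝ F w).prod P
  have hD : ContinuousOn D U := fun w hw =>
    (((hf w hw).fderiv_right (m := 0) (by simp)).continuousAt.congr (Filter.eventually_of_mem
      (hU.mem_nhds hw) fun w' hw' => (hf' w' hw').fderiv)).continuousWithinAt
  let e : W ≃L[ℝ] V × T := (LinearEquiv.ofInjectiveOfFinrankEq (D w₀ : W →ₗ[ℝ] V × T) hP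
    (by rw [hd, Module.finrank_prod])).toContinuousLinearEquiv
  have he : (e : W →L[ℝ] V × T) = D w₀ := by ext <;> rfl
  -- Restricting to points where the differential stays invertible makes the inverse smooth on the
  -- whole target, not just at the image of `w₀`.
  let U' : Set W := U ∩ D ⁻¹' Set.range ((↑) : (W ≃L[ℝ] V × T) → W →L[ℝ] V × T)
  have hU' : IsOpen U' := hD.isOpen_inter_preimage hU ContinuousLinearEquiv.isOpen
  have hw₀' : w₀ ∈ U' := ⟨hw₀, e, he⟩
  let Φ₀ := (hf w₀ hw₀).toOpenPartialHomeomorph f (f' := e) (by rw [he]; exact hf' w₀ hw₀) (by simp)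
  let Φ := Φ₀.restrOpen U' hU'
  have hΦ (w : W) : Φ w = f w := rfl
  refine ⟨Φ, ⟨ContDiffAt.mem_toOpenPartialHomeomorph_source _ _ _, hw₀'⟩, fun w hw => hw.2.1,
    fun w => rfl, fun w hw => hf w hw.2.1, fun z hz => ?_⟩
  have hz' := Φ.map_target hz
  obtain ⟨e', he'⟩ := hz'.2.2
  refine Φ.contDiffAt_symm (f₀' := e') hz ?_ (hf _ hz'.2.1)
  rw [he']
  exact hf' _ hz'.2.1

end LocalModel

/-! ### Existence of the intersection as a manifold -/

section Existence

variable {d m l s : ℕ} {N : Type*} [TopologicalSpace N]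
  [ChartedSpace (EuclideanSpace ℝ (Fin d)) N] [IsManifold (𝓡 d) ∞ N]
  {Sig : Type*} [TopologicalSpace Sig] [ChartedSpace (EuclideanSpace ℝ (Fin m)) Sig]
  [IsManifold (𝓡 m) ∞ Sig]
  {M : Type*} [TopologicalSpace M] [ChartedSpace (EuclideanSpace ℝ (Fin l)) M]
  [IsManifold (𝓡 l) ∞ M]

/-- A neighbourhood `t` of `a` is the preimage under `f` of g⁻¹(t), so continuity of `g` at points
of the image suffices. The left inverse used below comes from charts and need not be continuous
elsewhere. -/
theorem isEmbedding_of_continuousAt_leftInverse {X Y : Type*} [TopologicalSpace X]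
    [TopologicalSpace Y] {f : X → Y} {g : Y → X} (hf : Continuous f) (hgf : Function.LeftInverse g f)
    (hg : ∀ a, ContinuousAt g (f a)) : Topology.IsEmbedding f := by
  refine ⟨Topology.isInducing_iff_nhds.2 fun a => le_antisymm hf.continuousAt.le_comap ?_,
    hgf.injective⟩
  intro t ht
  refine Filter.mem_comap.2 ⟨g ⁻¹' t, hg a (by rwa [hgf a]), ?_⟩
  rw [← Set.preimage_comp, hgf.comp_eq_id]
  rfl

/-- The set where the expression of a map in given charts is defined. -/
def chartDomain (x : Sig → N) (q : Sig) (c : N) : Set (EuclideanSpace ℝ (Fin m)) :=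
  (extChartAt (𝓡 m) q).target ∩ (x ∘ (extChartAt (𝓡 m) q).symm) ⁻¹' (extChartAt (𝓡 d) c).source

theorem isOpen_chartDomain {x : Sig → N} (hx : Continuous x) (q : Sig) (c : N) :
    IsOpen (chartDomain (d := d) (m := m) x q c) :=
  (hx.comp_continuousOn (continuousOn_extChartAt_symm q)).isOpen_inter_preimage
    (isOpen_extChartAt_target q) (isOpen_extChartAt_source c)

theorem contDiffAt_chart_comp {x : Sig → N} (hx : ContMDiff (𝓡 m) (𝓡 d) ∞ x) {q : Sig} {c : N}
    {z : EuclideanSpace ℝ (Fin m)} (hz : z ∈ chartDomain (d := d) (m := m) x q c) :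
    ContDiffAt ℝ ∞ (extChartAt (𝓡 d) c ∘ x ∘ (extChartAt (𝓡 m) q).symm) z := by
  rw [← contMDiffAt_iff_contDiffAt]
  refine ContMDiffAt.comp z (contMDiffAt_extChartAt' ?_)
    (hx.contMDiffAt.comp z (contMDiffAt_extChartAt_symm hz.1))
  rw [← extChartAt_source (𝓡 d)]
  exact hz.2

theorem mem_chartDomain (x : Sig → N) {q : Sig} {c : N} (h : x q = c) :
    extChartAt (𝓡 m) q q ∈ chartDomain (d := d) (m := m) x q c := by
  refine ⟨mem_extChartAt_target q, ?_⟩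
  rw [Set.mem_preimage, Function.comp_apply, extChartAt_to_inv, h]
  exact mem_extChartAt_source c

/-- Transversality makes the difference of the two chart expressions a submersion at the base point;
its zero set in straightened coordinates is a slice, parametrized here by all of Euclidean space. -/
theorem exists_isIntersectionNear {x : Sig → N} {y : M → N} (hd : m + l = d + s)
    (hx : IsSmoothImmersion d m x) (hy : IsSmoothImmersion d l y) {q : Sig} {p : M} (hqp : x q = y p)
    (htop : (mfderiv (𝓡 m) (𝓡 d) x q :
        EuclideanSpace ℝ (Fin m) →L[ℝ] EuclideanSpace ℝ (Fin d)).range ⊔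
      (mfderiv (𝓡 l) (𝓡 d) y p :
        EuclideanSpace ℝ (Fin l) →L[ℝ] EuclideanSpace ℝ (Fin d)).range = ⊤) :
    ∃ (α : EuclideanSpace ℝ (Fin s) → Sig) (β : EuclideanSpace ℝ (Fin s) → M)
      (o : EuclideanSpace ℝ (Fin s)), IsIntersectionNear d m l s x y q p α β o := by
  let X : EuclideanSpace ℝ (Fin m) → EuclideanSpace ℝ (Fin d) :=
    extChartAt (𝓡 d) (x q) ∘ x ∘ (extChartAt (𝓡 m) q).symm
  let Y : EuclideanSpace ℝ (Fin l) → EuclideanSpace ℝ (Fin d) :=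
    extChartAt (𝓡 d) (x q) ∘ y ∘ (extChartAt (𝓡 l) p).symm
  let F : EuclideanSpace ℝ (Fin m) × EuclideanSpace ℝ (Fin l) → EuclideanSpace ℝ (Fin d) :=
    fun w => X w.1 - Y w.2
  let U := chartDomain (d := d) (m := m) x q (x q) ×ˢ chartDomain (d := d) (m := l) y p (x q)
  have hU : IsOpen U := (isOpen_chartDomain hx.1.continuous q _).prod
    (isOpen_chartDomain hy.1.continuous p _)
  have hF (w) (hw : w ∈ U) : ContDiffAt ℝ ∞ F w :=
    (ContDiffAt.comp (g := X) (f := Prod.fst) w (contDiffAt_chart_comp hx.1 hw.1) contDiffAt_fst).sub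
      (ContDiffAt.comp (g := Y) (f := Prod.snd) w (contDiffAt_chart_comp hy.1 hw.2) contDiffAt_snd)
  let w₀ := (extChartAt (𝓡 m) q q, extChartAt (𝓡 l) p p)
  have hw₀ : w₀ ∈ U := ⟨mem_chartDomain x rfl, mem_chartDomain y hqp.symm⟩
  have hF₀ : F w₀ = 0 := by
    simp only [F, X, Y, w₀, Function.comp_apply, extChartAt_to_inv, hqp, sub_self]
  have hs : Function.Surjective (fderiv ℝ F w₀) := by
    have hX : fderiv ℝ X w₀.1 = mfderiv (𝓡 m) (𝓡 d) x q :=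
      (mfderiv_eq_fderiv_writtenInExtChartAt hx.1.contMDiffAt).symm
    have hY : fderiv ℝ Y w₀.2 = mfderiv (𝓡 l) (𝓡 d) y p := by
      have : Y = writtenInExtChartAt (𝓡 l) (𝓡 d) p y := by simp only [Y, hqp]; rfl
      rw [this]
      exact (mfderiv_eq_fderiv_writtenInExtChartAt hy.1.contMDiffAt).symm
    have hX' : HasFDerivAt X (fderiv ℝ X w₀.1) w₀.1 :=
      ((contDiffAt_chart_comp hx.1 hw₀.1).differentiableAt (by simp)).hasFDerivAt
    have hY' : HasFDerivAt Y (fderiv ℝ Y w₀.2) w₀.2 :=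
      ((contDiffAt_chart_comp hy.1 hw₀.2).differentiableAt (by simp)).hasFDerivAt
    have h := ((hX'.comp w₀ hasFDerivAt_fst).sub (hY'.comp w₀ hasFDerivAt_snd)).fderiv
    intro v
    have hv : v ∈ (⊤ : Submodule ℝ (EuclideanSpace ℝ (Fin d))) := trivial
    have htop' : (fderiv ℝ X w₀.1).range ⊔ (fderiv ℝ Y w₀.2).range = ⊤ := by
      rw [hX, hY]
      exact htop
    obtain ⟨_, ⟨a, rfl⟩, _, ⟨b, rfl⟩, hab⟩ := Submodule.mem_sup.1 (htop'.ge hv)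
    -- The sign compensates for the subtraction in `F`.
    refine ⟨(a, -b), ?_⟩
    refine (congrArg (fun L : EuclideanSpace ℝ (Fin m) × EuclideanSpace ℝ (Fin l) →L[ℝ]
      EuclideanSpace ℝ (Fin d) => L (a, -b)) h).trans ?_
    change fderiv ℝ X w₀.1 a - fderiv ℝ Y w₀.2 (-b) = v
    rw [map_neg, sub_neg_eq_add]
    exact hab
  obtain ⟨Φ, hΦ₀, hΦU, hΦF, hΦ, hΦs⟩ := exists_openPartialHomeomorph_fst_eq
    (T := EuclideanSpace ℝ (Fin s)) hU hF hw₀ hs (by simpa using hd)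
  have hΦw₀ : Φ w₀ = (0, (Φ w₀).2) := Prod.ext ((hΦF w₀).trans hF₀) rfl
  have h₀ : ((0 : EuclideanSpace ℝ (Fin d)), (Φ w₀).2) ∈ Φ.target := hΦw₀ ▸ Φ.map_source hΦ₀
  obtain ⟨r, hr, hball⟩ : ∃ r > 0, ∀ t ∈ Metric.ball (Φ w₀).2 r,
      ((0 : EuclideanSpace ℝ (Fin d)), t) ∈ Φ.target :=
    Metric.mem_nhds_iff.1 ((Continuous.prodMk_right
      (0 : EuclideanSpace ℝ (Fin d))).continuousAt.preimage_mem_nhds (Φ.open_target.mem_nhds h₀))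
  -- A diffeomorphism of Euclidean space onto the ball, with 0 going to the centre; thus the whole
  -- space serves as `S`, with base point 0.
  let u := OpenPartialHomeomorph.univBall (Φ w₀).2 r
  have hu (t) : u t ∈ Metric.ball (Φ w₀).2 r := by
    rw [← OpenPartialHomeomorph.univBall_target _ hr]
    exact u.map_source (by simp [u])
  have hut (t) : u.symm (u t) = t := u.left_inv (by simp [u])
  have hus {t} (ht : t ∈ Metric.ball (Φ w₀).2 r) : u (u.symm t) = t :=
    u.right_inv (by rwa [OpenPartialHomeomorph.univBall_target _ hr])
  let σ (t : EuclideanSpace ℝ (Fin s)) := Φ.symm (0, u t)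
  have hσΦ (t) : Φ (σ t) = (0, u t) := Φ.right_inv (hball _ (hu t))
  have hσs (t) : σ t ∈ Φ.source := Φ.map_target (hball _ (hu t))
  have hσU (t) : σ t ∈ U := hΦU (hσs t)
  have hσ : ContDiff ℝ ∞ σ := contDiff_iff_contDiffAt.2 fun t =>
    ContDiffAt.comp t (hΦs _ (hball _ (hu t)))
      (contDiffAt_const.prodMk OpenPartialHomeomorph.contDiff_univBall.contDiffAt)
  let α (t : EuclideanSpace ℝ (Fin s)) := (extChartAt (𝓡 m) q).symm (σ t).1
  let β (t : EuclideanSpace ℝ (Fin s)) := (extChartAt (𝓡 l) p).symm (σ t).2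
  let Θ (w : Sig × M) := (extChartAt (𝓡 m) q w.1, extChartAt (𝓡 l) p w.2)
  have hΘ (t) : Θ (α t, β t) = σ t := Prod.ext ((extChartAt (𝓡 m) q).right_inv (hσU t).1.1)
    ((extChartAt (𝓡 l) p).right_inv (hσU t).2.1)
  -- A left inverse of (α, β), smooth near the image: it yields both the topological embedding and
  -- the injectivity of the differential.
  let R (w : Sig × M) := u.symm (Φ (Θ w)).2
  have hR (t) : R (α t, β t) = t := by
    simp only [R, hΘ, hσΦ, hut]
  have hα : ContMDiff (𝓡 s) (𝓡 m) ∞ α := fun t =>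
    (contMDiffAt_extChartAt_symm (hσU t).1.1).comp t (contDiff_fst.comp hσ).contMDiff.contMDiffAt
  have hβ : ContMDiff (𝓡 s) (𝓡 l) ∞ β := fun t =>
    (contMDiffAt_extChartAt_symm (hσU t).2.1).comp t (contDiff_snd.comp hσ).contMDiff.contMDiffAt
  have hRs (t) : ContMDiffAt ((𝓡 m).prod (𝓡 l)) (𝓡 s) ∞ R (α t, β t) := by
    have hq : α t ∈ (chartAt (EuclideanSpace ℝ (Fin m)) q).source := by
      rw [← extChartAt_source (𝓡 m)]
      exact (extChartAt (𝓡 m) q).map_target (hσU t).1.1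
    have hp : β t ∈ (chartAt (EuclideanSpace ℝ (Fin l)) p).source := by
      rw [← extChartAt_source (𝓡 l)]
      exact (extChartAt (𝓡 l) p).map_target (hσU t).2.1
    have h1 : ContMDiffAt ((𝓡 m).prod (𝓡 l))
        𝓘(ℝ, EuclideanSpace ℝ (Fin m) × EuclideanSpace ℝ (Fin l)) ∞ Θ (α t, β t) :=
      ((contMDiffAt_extChartAt' hq).comp (α t, β t) contMDiffAt_fst).prodMk_space
        ((contMDiffAt_extChartAt' hp).comp (α t, β t) contMDiffAt_snd)
    have h2 : ContDiffAt ℝ ∞ (fun w => u.symm (Φ w).2) (Θ (α t, β t)) := by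
      rw [hΘ]
      refine ContDiffAt.comp (σ t) ?_ (contDiffAt_snd.comp (σ t) (hΦ _ (hσs t)))
      refine OpenPartialHomeomorph.contDiffOn_univBall_symm.contDiffAt
        (Metric.isOpen_ball.mem_nhds ?_)
      rw [hσΦ]
      exact hu t
    exact ContMDiffAt.comp (g := fun w => u.symm (Φ w).2) (f := Θ) (α t, β t) h2.contMDiffAt h1
  have hcomm (t) : x (α t) = y (β t) := by
    refine (extChartAt (𝓡 d) (x q)).injOn (hσU t).1.2 (hσU t).2.2 (sub_eq_zero.1 ?_)
    exact (hΦF (σ t)).symm.trans (congrArg Prod.fst (hσΦ t))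
  have hu0 : σ 0 = w₀ := by
    simp only [σ, u, OpenPartialHomeomorph.univBall_apply_zero, ← hΦw₀, Φ.left_inv hΦ₀]
  refine ⟨α, β, 0, ⟨by simp only [α, hu0, w₀, extChartAt_to_inv],
    by simp only [β, hu0, w₀, extChartAt_to_inv], hα, hβ, hcomm, ⟨hx.1.comp hα, fun t => ?_⟩,
    isEmbedding_of_continuousAt_leftInverse (hα.continuous.prodMk hβ.continuous) hR
      fun t => (hRs t).continuousAt, ?_⟩⟩
  · have hαd : MDifferentiableAt (𝓡 s) (𝓡 m) α t := hα.mdifferentiable (by simp) t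
    have hβd : MDifferentiableAt (𝓡 s) (𝓡 l) β t := hβ.mdifferentiable (by simp) t
    have hxd : MDifferentiableAt (𝓡 m) (𝓡 d) x (α t) := hx.1.mdifferentiable (by simp) _
    have hyd : MDifferentiableAt (𝓡 l) (𝓡 d) y (β t) := hy.1.mdifferentiable (by simp) _
    have hRd := (hRs t).mdifferentiableAt (by simp)
    -- A vector killed by d(x ∘ α) = d(y ∘ β) is killed by dα and dβ, as dx and dy are injective;
    -- differentiating R ∘ (α, β) = id then kills it.
    refine (injective_iff_map_eq_zero (mfderiv (𝓡 s) (𝓡 d) (x ∘ α) t)).2 fun v hv => ?_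
    have h1 : mfderiv (𝓡 s) (𝓡 m) α t v = 0 := by
      rw [mfderiv_comp t hxd hαd] at hv
      exact hx.2 _ (hv.trans (map_zero _).symm)
    have h2 : mfderiv (𝓡 s) (𝓡 l) β t v = 0 := by
      have (f : EuclideanSpace ℝ (Fin s) → N) (hf : f = y ∘ β)
          (hv : (mfderiv (𝓡 s) (𝓡 d) f t v : EuclideanSpace ℝ (Fin d)) = 0) :
          mfderiv (𝓡 s) (𝓡 l) β t v = 0 := by
        subst hf
        rw [mfderiv_comp t hyd hβd] at hv
        exact hy.2 _ (hv.trans (map_zero _).symm)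
      exact this _ (funext hcomm) hv
    have h3 := mfderiv_comp t hRd (hαd.prodMk hβd)
    have h4 : R ∘ (fun t => (α t, β t)) = id := funext hR
    rw [h4, mfderiv_id, hαd.mfderiv_prod hβd] at h3
    have h5 := congrArg (fun L : EuclideanSpace ℝ (Fin s) →L[ℝ] EuclideanSpace ℝ (Fin s) => L v) h3
    refine h5.trans ?_
    have h6 : (mfderiv (𝓡 s) (𝓡 m) α t).prod (mfderiv (𝓡 s) (𝓡 l) β t) v = 0 := Prod.ext h1 h2
    let K : EuclideanSpace ℝ (Fin m) × EuclideanSpace ℝ (Fin l) →L[ℝ] EuclideanSpace ℝ (Fin s) :=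
      mfderiv ((𝓡 m).prod (𝓡 l)) (𝓡 s) R (α t, β t)
    exact (congrArg K h6).trans (map_zero K)
  · have hΘc : ContinuousAt Θ (q, p) :=
      (ContinuousAt.comp (f := Prod.fst) (x := (q, p)) (continuousAt_extChartAt q) continuousAt_fst).prodMk
        (ContinuousAt.comp (f := Prod.snd) (x := (q, p)) (continuousAt_extChartAt p) continuousAt_snd)
    have h1 : ∀ᶠ w in 𝓝 (q, p), w.1 ∈ (extChartAt (𝓡 m) q).source :=
      continuousAt_fst.eventually_mem (extChartAt_source_mem_nhds q)
    have h2 : ∀ᶠ w in 𝓝 (q, p), w.2 ∈ (extChartAt (𝓡 l) p).source :=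
      continuousAt_snd.eventually_mem (extChartAt_source_mem_nhds p)
    have h3 : ∀ᶠ w in 𝓝 (q, p), Θ w ∈ Φ.source :=
      hΘc.eventually_mem (Φ.open_source.mem_nhds hΦ₀)
    have h4 : ∀ᶠ w in 𝓝 (q, p), (Φ (Θ w)).2 ∈ Metric.ball (Φ w₀).2 r :=
      ((continuousAt_snd.comp (Φ.continuousAt hΦ₀)).comp_of_eq hΘc rfl).eventually_mem
        (Metric.ball_mem_nhds _ hr)
    filter_upwards [h1, h2, h3, h4] with w hw1 hw2 hw3 hw4 hw
    have h5 : Φ (Θ w) = (0, (Φ (Θ w)).2) := by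
      refine Prod.ext ((hΦF _).trans ?_) rfl
      simp only [F, X, Y, Θ, Function.comp_apply, (extChartAt (𝓡 m) q).left_inv hw1,
        (extChartAt (𝓡 l) p).left_inv hw2, hw, sub_self]
    -- A common point has first straightened coordinate 0, so its second coordinate is the
    -- parameter.
    have h6 : σ (u.symm (Φ (Θ w)).2) = Θ w := by
      simp only [σ]
      rw [hus hw4, ← h5, Φ.left_inv hw3]
    refine ⟨u.symm (Φ (Θ w)).2, Prod.ext ?_ ?_⟩
    · simp only [α, h6]
      exact (extChartAt (𝓡 m) q).left_inv hw1
    · simp only [β, h6]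
      exact (extChartAt (𝓡 l) p).left_inv hw2

end Existence

theorem theorem4p6 (m n s : ℕ) (hm : 2 ≤ m) (hs : 0 < s) (hsm : s ≤ m - 1)
    {N : Type*} [TopologicalSpace N] [ChartedSpace (EuclideanSpace ℝ (Fin (m + n))) N]
    [IsManifold (𝓡 (m + n)) ∞ N] (g : SmoothMetric (m + n) N)
    {Sig : Type*} [TopologicalSpace Sig] [ChartedSpace (EuclideanSpace ℝ (Fin m)) Sig]
    [IsManifold (𝓡 m) ∞ Sig]
    (x : Sig → N) (hx : IsSmoothImmersion (m + n) m x)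
    (q : Sig) (hq : IsUmbilicAt m g.inner x q)
    {M : Type*} [TopologicalSpace M] [ChartedSpace (EuclideanSpace ℝ (Fin (s + n))) M]
    [IsManifold (𝓡 (s + n)) ∞ M]
    (y : M → N) (hy : IsSmoothImmersion (m + n) (s + n) y)
    (p : M) (hqp : x q = y p)
    (hgeo : IsTotallyGeodesicAt (s + n) g.inner y p)
    (hnormal : ∀ w ∈ normalSpace m g.inner x q, ∃ v : TangentSpace (𝓡 (s + n)) p,
      (⟨y p, mfderiv (𝓡 (s + n)) (𝓡 (m + n)) y p v⟩ : TangentBundle (𝓡 (m + n)) N) = ⟨x q, w⟩) :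
    (∃ (S : Type) (_ : TopologicalSpace S) (_ : ChartedSpace (EuclideanSpace ℝ (Fin s)) S)
      (_ : IsManifold (𝓡 s) ∞ S) (α : S → Sig) (β : S → M) (o : S),
      IsIntersectionNear (m + n) m (s + n) s x y q p α β o) ∧
    ∀ (S : Type*) [TopologicalSpace S] [ChartedSpace (EuclideanSpace ℝ (Fin s)) S]
      [IsManifold (𝓡 s) ∞ S] (α : S → Sig) (β : S → M) (o : S),
      IsIntersectionNear (m + n) m (s + n) s x y q p α β o →
      (⟨x (α o), meanCurvatureVector s g.inner (x ∘ α) o⟩ :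
        TangentBundle (𝓡 (m + n)) N) = ⟨x q, meanCurvatureVector m g.inner x q⟩ := by
  -- Equality in the tangent bundle gives a heterogeneous equality of vectors, which is an honest
  -- one because all fibres are the same Euclidean space by definition.
  have hnormal' (w) (hw : w ∈ normalSpace m g.inner x q) : ∃ v : TangentSpace (𝓡 (s + n)) p,
      (mfderiv (𝓡 (s + n)) (𝓡 (m + n)) y p v : EuclideanSpace ℝ (Fin (m + n))) = w := by
    obtain ⟨v, hv⟩ := hnormal w hw
    exact ⟨v, eq_of_heq (Bundle.TotalSpace.mk.inj hv).2⟩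
  have hd : m + (s + n) = (m + n) + s := by omega
  constructor
  · obtain ⟨α, β, o, h⟩ := exists_isIntersectionNear hd hx hy hqp
      (range_sup_range_eq_top g (hx.2 q) hnormal')
    exact ⟨EuclideanSpace ℝ (Fin s), inferInstance, inferInstance, inferInstance, α, β, o, h⟩
  · intro S _ _ _ α β o h
    obtain rfl := h.left_base
    obtain rfl := h.right_base
    exact congrArg (fun w : EuclideanSpace ℝ (Fin (m + n)) =>
      (⟨x (α o), w⟩ : TangentBundle (𝓡 (m + n)) N))
      (meanCurvatureVector_comp_eq g hs hd hx hy h.smooth_left h.smooth_right (funext h.comm)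
        h.immersion hq hgeo hnormal')
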